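/- **Theorem 4.2.** Let $M^3$ be a smooth 3-dimensional Riemannian manifold with Levi-Civita connection $\nabla$, and let $\Sigma^2$ be a regular (immersed) smooth surface in $M^3$ with smooth unit normal field $\nu$ and shape operator $A(X)=-\nabla_X\nu$. Suppose that $\Sigma^2$ is a surface of constant parallel angle $\theta$ with axis $V$: $V$ is a smooth unit vector field of $M^3$ along $\Sigma^2$ that is parallel along every smooth curve of $\Sigma^2$, and the angle between $V$ and $\nu$ equals the constant $\theta$ at every point of $\Sigma^2$. Then: 1. $\Sigma^2$ is extrinsically flat, i.e. its extrinsic curvature $K_{ext}=\det A$ vanishes identically. 2. $\Sigma^2$ is ruled: each point of $\Sigma^2$ has a neighbourhood with a regular injective smooth parametrization $X(u,v)$, $(u,v)\in(-\delta,\delta)^2$, for which every coordinate line $v\mapsto X(u,v)$ (a ruling) is a geodesic of $M^3$. 3. The parametrizations in 2 can be chosen such that the rulings are tangent to the projection $T=V-\langle V,\nu\rangle\,\nu$ of the axis onto $\Sigma^2$: at each point $X(u,v)$ the vector $T$ lies in the line spanned by $\partial_v X$. (In particular, where $T\neq 0$, i.e. $\sin\theta\neq0$, the rulings have the direction of $T$.)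 -/

import Mathlib

open Bundle Manifold Set
open scoped ContDiff Topology

noncomputable section

namespace ConstAngle

section Connection

variable {E : Type*} [NormedAddCommGroup E] [NormedSpace ℝ E]
  {M : Type*} [TopologicalSpace M] [ChartedSpace E M]

/-- The unit tangent vector `d/dt` of the real line. -/
def unitTangent (t : ℝ) : TangentSpace 𝓘(ℝ, ℝ) t :=
  (NormedSpace.fromTangentSpace t).symm 1

/-- The velocity of a curve in `M`. -/
def velocity (c : ℝ → M) (t : ℝ) : TangentSpace 𝓘(ℝ, E) (c t) :=
  mfderiv 𝓘(ℝ, ℝ) 𝓘(ℝ, E) c t (unitTangent t)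

variable [IsManifold 𝓘(ℝ, E) ∞ M]

/-- The coordinate vector field `∂ₐ` of the chart around `x₀`, at the point `x`. -/
def coordVec (x₀ : M) (a : E) (x : M) : TangentSpace 𝓘(ℝ, E) x :=
  (trivializationAt E (TangentSpace 𝓘(ℝ, E)) x₀).symmL ℝ x a

/-- The components in the chart around `x₀` of a tangent vector at `x₀`. -/
def coords (x₀ : M) (v : TangentSpace 𝓘(ℝ, E) x₀) : E :=
  (trivializationAt E (TangentSpace 𝓘(ℝ, E)) x₀).continuousLinearMapAt ℝ x₀ v

section Along

variable {N : Type*}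

/-- The components, in the chart around `x₀`, of a vector field `W` along a map `g : N → M`. -/
def fieldCoords (x₀ : M) (g : N → M) (W : ∀ q, TangentSpace 𝓘(ℝ, E) (g q)) (q : N) : E :=
  (trivializationAt E (TangentSpace 𝓘(ℝ, E)) x₀ (⟨g q, W q⟩ : TangentBundle 𝓘(ℝ, E) M)).2

variable (F : Type*) [NormedAddCommGroup F] [NormedSpace ℝ F]
  [TopologicalSpace N] [ChartedSpace F N]

/-- `W` is a smooth vector field of `M` along the map `g : N → M`. -/
def IsSmoothFieldAlong (g : N → M) (W : ∀ q, TangentSpace 𝓘(ℝ, E) (g q)) : Prop :=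
  ContMDiff 𝓘(ℝ, F) (𝓘(ℝ, E).prod 𝓘(ℝ, E)) ∞
    (fun q => (⟨g q, W q⟩ : TangentBundle 𝓘(ℝ, E) M))

end Along

variable [FiniteDimensional ℝ E] [RiemannianBundle (fun x : M => TangentSpace 𝓘(ℝ, E) x)]

/-- The coordinate expression `y ↦ g_y(∂ₐ, ∂_b)` of the Riemannian metric in the chart
around `x₀`. -/
def chartMetric (x₀ : M) (a b : E) (y : E) : ℝ :=
  inner ℝ (coordVec x₀ a ((extChartAt 𝓘(ℝ, E) x₀).symm y))
    (coordVec x₀ b ((extChartAt 𝓘(ℝ, E) x₀).symm y))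

/-- The Christoffel symbol of the first kind at `x₀`, in the chart around `x₀`:
`½ (∂ₐ g(∂_b, ∂_c) + ∂_b g(∂ₐ, ∂_c) - ∂_c g(∂ₐ, ∂_b))`. -/
def christoffelFirst (x₀ : M) (a b c : E) : ℝ :=
  (1 / 2 : ℝ) *
    (fderiv ℝ (chartMetric x₀ b c) (extChartAt 𝓘(ℝ, E) x₀ x₀) a
      + fderiv ℝ (chartMetric x₀ a c) (extChartAt 𝓘(ℝ, E) x₀ x₀) b
      - fderiv ℝ (chartMetric x₀ a b) (extChartAt 𝓘(ℝ, E) x₀ x₀) c)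

/-- The Christoffel symbol of the second kind `Γ(v, w)` of the Levi-Civita connection, at `x₀` and
in the chart around `x₀`: the vector whose inner product with `∂_c` is the Christoffel symbol of
the first kind. The last index is raised with an orthonormal basis of the tangent space. -/
def christoffel (x₀ : M) (v w : TangentSpace 𝓘(ℝ, E) x₀) : TangentSpace 𝓘(ℝ, E) x₀ :=
  haveI : FiniteDimensional ℝ (TangentSpace 𝓘(ℝ, E) x₀) := inferInstanceAs (FiniteDimensional ℝ E)
  ∑ i, christoffelFirst x₀ (coords x₀ v) (coords x₀ w)
      (coords x₀ (stdOrthonormalBasis ℝ (TangentSpace 𝓘(ℝ, E) x₀) i)) •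
    stdOrthonormalBasis ℝ (TangentSpace 𝓘(ℝ, E) x₀) i

variable (F : Type*) [NormedAddCommGroup F] [NormedSpace ℝ F]
  {N : Type*} [TopologicalSpace N] [ChartedSpace F N]

/-- The Levi-Civita covariant derivative `∇_v W` of a vector field `W` along a map `g : N → M`, in
the direction of `v ∈ T_q N`. In the chart around `g q` it is
`(∇_v W)ᵏ = v(Wᵏ) + Γᵏᵢⱼ (dg v)ⁱ Wʲ`. -/
def covDeriv (g : N → M) (W : ∀ q, TangentSpace 𝓘(ℝ, E) (g q)) (q : N)
    (v : TangentSpace 𝓘(ℝ, F) q) : TangentSpace 𝓘(ℝ, E) (g q) :=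
  coordVec (E := E) (g q) (mvfderiv 𝓘(ℝ, F) (fieldCoords (g q) g W) q v) (g q)
    + christoffel (g q) (mfderiv 𝓘(ℝ, F) 𝓘(ℝ, E) g q v) (W q)

/-- The field `W` along the curve `c` is parallel on the open set `J` of parameters. -/
def IsParallelOn (c : ℝ → M) (W : ∀ t, TangentSpace 𝓘(ℝ, E) (c t)) (J : Set ℝ) : Prop :=
  ∀ t ∈ J, covDeriv ℝ c W t (unitTangent t) = 0

/-- The curve `c` is, on the open set `J` of parameters, a geodesic of `M`: it is smooth and its
velocity is parallel. -/
def IsGeodesicOn (c : ℝ → M) (J : Set ℝ) : Prop :=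
  ContMDiffOn 𝓘(ℝ, ℝ) 𝓘(ℝ, E) ∞ c J ∧ IsParallelOn (E := E) c (velocity c) J

end Connection

section Surface

variable {M : Type*} [TopologicalSpace M] [ChartedSpace (EuclideanSpace ℝ (Fin 3)) M]
  [IsManifold (𝓡 3) ∞ M] [RiemannianBundle (fun x : M => TangentSpace (𝓡 3) x)]
  {S : Type*} [TopologicalSpace S] [ChartedSpace (EuclideanSpace ℝ (Fin 2)) S]
  [IsManifold (𝓡 2) ∞ S]

/-- `f : S → M` is a (possibly immersed) regular surface with smooth unit normal `ν`. -/
structure IsSurfaceWithNormal (f : S → M) (ν : ∀ p, TangentSpace (𝓡 3) (f p)) : Prop where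
  smooth : ContMDiff (𝓡 2) (𝓡 3) ∞ f
  immersion : ∀ p, Function.Injective (mfderiv (𝓡 2) (𝓡 3) f p)
  smooth_normal : IsSmoothFieldAlong (EuclideanSpace ℝ (Fin 2)) f ν
  norm_normal : ∀ p, ‖ν p‖ = 1
  orthogonal : ∀ p (v : TangentSpace (𝓡 2) p), inner ℝ (mfderiv (𝓡 2) (𝓡 3) f p v) (ν p) = 0

/-- The unit field `V` along the surface is parallel along every curve of the surface and makes
the constant angle `θ` with the unit normal `ν`. -/
structure IsConstParallelAngle (f : S → M) (ν : ∀ p, TangentSpace (𝓡 3) (f p)) (θ : ℝ)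
    (V : ∀ p, TangentSpace (𝓡 3) (f p)) : Prop where
  smooth : IsSmoothFieldAlong (EuclideanSpace ℝ (Fin 2)) f V
  norm_eq_one : ∀ p, ‖V p‖ = 1
  parallel : ∀ (γ : ℝ → S) (J : Set ℝ), IsOpen J → ContMDiffOn 𝓘(ℝ, ℝ) (𝓡 2) ∞ γ J →
    IsParallelOn (fun t => f (γ t)) (fun t => V (γ t)) J
  angle_eq : ∀ p, InnerProductGeometry.angle (V p) (ν p) = θ

/-- The first fundamental form `g(v, w)` of the surface. -/
def firstForm (f : S → M) (p : S) (v w : TangentSpace (𝓡 2) p) : ℝ :=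
  inner ℝ (mfderiv (𝓡 2) (𝓡 3) f p v) (mfderiv (𝓡 2) (𝓡 3) f p w)

/-- The (scalar) second fundamental form `⟨A v, w⟩`, with `A v = -∇_v ν`. -/
def secondForm (f : S → M) (ν : ∀ p, TangentSpace (𝓡 3) (f p)) (p : S)
    (v w : TangentSpace (𝓡 2) p) : ℝ :=
  inner ℝ (-covDeriv (EuclideanSpace ℝ (Fin 2)) f ν p v) (mfderiv (𝓡 2) (𝓡 3) f p w)

/-- The coordinate basis of the tangent plane `T_p S`. -/
def tangentBasis (p : S) (i : Fin 2) : TangentSpace (𝓡 2) p :=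
  (EuclideanSpace.single i (1 : ℝ) : EuclideanSpace ℝ (Fin 2))

/-- The extrinsic curvature, i.e. the determinant of the shape operator `A`, computed
as `det (hᵢⱼ) / det (gᵢⱼ)`. -/
def extrinsicCurvature (f : S → M) (ν : ∀ p, TangentSpace (𝓡 3) (f p)) (p : S) : ℝ :=
  (Matrix.of fun i j => secondForm f ν p (tangentBasis p i) (tangentBasis p j)).det /
    (Matrix.of fun i j => firstForm f p (tangentBasis p i) (tangentBasis p j)).det

/-- The surface is extrinsically flat. -/
def IsExtrinsicallyFlat (f : S → M) (ν : ∀ p, TangentSpace (𝓡 3) (f p)) : Prop :=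
  ∀ p, extrinsicCurvature f ν p = 0

/-- `X` is a ruled parametrization of the surface around `p`: a regular injective smooth
parametrization of a neighbourhood of `p` by an open square, centred at `p`, whose coordinate lines
`v ↦ X(u, v)` are geodesics of the ambient manifold `M` (the rulings). -/
structure IsRuledParametrization (f : S → M) (p : S) (δ : ℝ) (X : ℝ × ℝ → S) : Prop where
  pos : 0 < δ
  center : X (0, 0) = p
  smooth : ContMDiffOn 𝓘(ℝ, ℝ × ℝ) (𝓡 2) ∞ X (Ioo (-δ) δ ×ˢ Ioo (-δ) δ)
  regular : ∀ z ∈ Ioo (-δ) δ ×ˢ Ioo (-δ) δ,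
    Function.Injective (mfderiv 𝓘(ℝ, ℝ × ℝ) (𝓡 2) X z)
  injOn : InjOn X (Ioo (-δ) δ ×ˢ Ioo (-δ) δ)
  geodesic : ∀ u ∈ Ioo (-δ) δ,
    IsGeodesicOn (E := EuclideanSpace ℝ (Fin 3)) (fun v => f (X (u, v))) (Ioo (-δ) δ)

/-- The surface is ruled: around each of its points it is parametrized by a one-parameter family of
geodesics of the ambient manifold. -/
def IsRuled (f : S → M) : Prop :=
  ∀ p, ∃ δ X, IsRuledParametrization f p δ X

/-- The projection `V - ⟨V, ν⟩ ν` of a field `V` to the tangent planes of the surface. -/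
def tangentialPart (f : S → M) (ν V : ∀ p, TangentSpace (𝓡 3) (f p)) (p : S) :
    TangentSpace (𝓡 3) (f p) :=
  V p - inner ℝ (V p) (ν p) • ν p

/-- The surface is ruled by rulings that are tangent to the field `T`: at every point, `T` lies in
the line spanned by the velocity of the ruling. -/
def IsRuledAlong (f : S → M) (T : ∀ p, TangentSpace (𝓡 3) (f p)) : Prop :=
  ∀ p, ∃ δ X, IsRuledParametrization f p δ X ∧
    ∀ u ∈ Ioo (-δ) δ, ∀ v ∈ Ioo (-δ) δ,
      T (X (u, v)) ∈ Submodule.span ℝ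
        {velocity (E := EuclideanSpace ℝ (Fin 3)) (fun s => f (X (u, s))) v}

end Surface

end ConstAngle

end

/-! ### Smooth dependence of the solutions of an autonomous ODE on initial values -/

/-! Put k = cos θ and T = V - k ν, the tangential part of the axis. Since V is parallel,
differentiating ⟨V, ν⟩ = k gives ⟨∇_a ν, V⟩ = 0, and |ν| = 1 gives ⟨∇_a ν, ν⟩ = 0; hence ⟨∇_a ν, T⟩
= 0 for every tangent a (`inner_dirCov_normal_axis`, `inner_dirCov_normal_normal`). Moreover |T|² =
1 - k² is constant, so T vanishes nowhere or identically.

If T ≠ 0, then T lies in the kernel of the second fundamental form, so det A = 0. By symmetry of A,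
∇_T T = ∇_T V - k ∇_T ν = k A T = 0, so the integral curves of T are geodesics of M, and flowing a
transverse segment along T gives the ruled parametrization (`hasRuledCoordinates_of_ne`). If T = 0,
then ν = k V is itself parallel and A = 0. The surface is totally geodesic, its intrinsic geodesics
are geodesics of M, and tangency to T is trivial. A family of intrinsic geodesics comes from the
Hamiltonian flow of the first fundamental form (`hasRuledCoordinates_of_flat`).

Two supports carry this. The first is a smooth local flow, jointly in time and initial value
(`exists_smooth_flow`), obtained from the inverse function theorem on a space of paths. The second
is that the connection given by Christoffel symbols is metric (`hasFDerivAt_inner`) and torsion free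
(`covDeriv_pushField_symm`); the surface theory uses these and the chain rule `covDeriv_comp`
instead of coordinates. -/

noncomputable section

namespace SmoothFlow

/-! ### Smoothness of postcomposition on spaces of continuous maps -/

section PostComp
universe u


variable {K : Type*} [TopologicalSpace K] [CompactSpace K]

instance instNormedAddCommGroupCLM (E G : Type*) [NormedAddCommGroup E] [NormedSpace ℝ E]
    [NormedAddCommGroup G] [NormedSpace ℝ G] : NormedAddCommGroup C(K, E →L[ℝ] G) :=
  ContinuousMap.instNormedAddCommGroup

instance instSeminormedAddCommGroupCLM (E G : Type*) [NormedAddCommGroup E] [NormedSpace ℝ E]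
    [NormedAddCommGroup G] [NormedSpace ℝ G] : SeminormedAddCommGroup C(K, E →L[ℝ] G) :=
  NormedAddCommGroup.toSeminormedAddCommGroup

instance instPseudoMetricSpaceCLM (E G : Type*) [NormedAddCommGroup E] [NormedSpace ℝ E]
    [NormedAddCommGroup G] [NormedSpace ℝ G] : PseudoMetricSpace C(K, E →L[ℝ] G) :=
  SeminormedAddCommGroup.toPseudoMetricSpace

/-- Pointwise application of a continuous family of continuous linear maps. -/
def pointwiseApply (E G : Type*) [NormedAddCommGroup E] [NormedSpace ℝ E]
    [NormedAddCommGroup G] [NormedSpace ℝ G] : C(K, E →L[ℝ] G) →L[ℝ] C(K, E) →L[ℝ] C(K, G) :=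
  LinearMap.mkContinuous₂
    (LinearMap.mk₂ ℝ (fun (A : C(K, E →L[ℝ] G)) (h : C(K, E)) =>
        (⟨fun k => A k (h k), by fun_prop⟩ : C(K, G)))
      (by intros; ext; simp) (by intros; ext; simp) (by intros; ext; simp) (by intros; ext; simp))
    1 (by
      intro A h
      rw [one_mul]
      refine (ContinuousMap.norm_le _ (by positivity)).2 fun k => ?_
      exact ((A k).le_opNorm _).trans
        (mul_le_mul (A.norm_coe_le_norm k) (h.norm_coe_le_norm k) (norm_nonneg _) (norm_nonneg _)))

@[simp] lemma pointwiseApply_apply {E G : Type*} [NormedAddCommGroup E] [NormedSpace ℝ E]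
    [NormedAddCommGroup G] [NormedSpace ℝ G] (A : C(K, E →L[ℝ] G)) (h : C(K, E)) (k : K) :
    pointwiseApply E G A h k = A k (h k) := rfl

/-- The mean value inequality is applied at each k on a ball whose radius does not depend on k,
which is possible because postcomposition with the derivative is continuous in the sup norm. -/
lemma hasFDerivAt_postcomp {E G : Type*} [NormedAddCommGroup E] [NormedSpace ℝ E]
    [NormedAddCommGroup G] [NormedSpace ℝ G] (F : C(E, G)) (F' : C(E, E →L[ℝ] G))
    (hF : ∀ x, HasFDerivAt F (F' x) x) (γ : C(K, E)) :
    HasFDerivAt (fun γ : C(K, E) => F.comp γ) (pointwiseApply E G (F'.comp γ)) γ := by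
  rw [hasFDerivAt_iff_isLittleO, Asymptotics.isLittleO_iff]
  intro ε hε
  have hc : ContinuousAt (fun γ : C(K, E) => F'.comp γ) γ :=
    (ContinuousMap.continuous_postcomp F').continuousAt
  obtain ⟨δ, hδ, H⟩ := Metric.continuousAt_iff.1 hc ε hε
  filter_upwards [Metric.ball_mem_nhds γ hδ] with η hη
  refine (ContinuousMap.norm_le _ (by positivity)).2 fun k => ?_
  have key : ‖F (η k) - F (γ k) - F' (γ k) (η k - γ k)‖ ≤ ε * ‖η k - γ k‖ := by
    refine Convex.norm_image_sub_le_of_norm_hasFDerivWithin_le' (𝕜 := ℝ)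
      (s := Metric.ball (γ k) δ) (fun y _ => (hF y).hasFDerivWithinAt) ?_
      (convex_ball _ _) (Metric.mem_ball_self hδ) ?_
    · intro y hy
      -- Translating γ by a constant reaches any y in the ball at parameter k, so the sup-norm
      -- modulus of continuity bounds `F' y - F' (γ k)`.
      have h1 : dist (γ + ContinuousMap.const K (y - γ k)) γ < δ := by
        rw [dist_eq_norm, add_sub_cancel_left]
        refine lt_of_le_of_lt ((ContinuousMap.norm_le _ (norm_nonneg (y - γ k))).2 fun _ => ?_)
          (mem_ball_iff_norm.1 hy)
        simp
      have h2 := (ContinuousMap.dist_apply_le_dist k).trans_lt (H h1)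
      simpa [dist_eq_norm] using h2.le
    · exact (ContinuousMap.dist_apply_le_dist k).trans_lt hη
  refine key.trans ?_
  gcongr
  exact (η - γ).norm_coe_le_norm k

/-- Induction on the order: the derivative is postcomposition with `F'` followed by the bounded
bilinear `pointwiseApply`. The target `G` is quantified inside because it becomes `E →L[ℝ] G`, and
the common universe keeps that space admissible. -/
theorem contDiff_postcomp_nat {E : Type u} [NormedAddCommGroup E] [NormedSpace ℝ E] (n : ℕ) :
    ∀ {G : Type u} [NormedAddCommGroup G] [NormedSpace ℝ G] (F : C(E, G)), ContDiff ℝ n F →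
      ContDiff ℝ n (fun γ : C(K, E) => F.comp γ) := by
  induction n with
  | zero =>
    intro G _ _ F _
    exact contDiff_zero.2 (ContinuousMap.continuous_postcomp F)
  | succ n ih =>
    intro G _ _ F hF
    push_cast at hF ⊢
    obtain ⟨F', hF', hd⟩ := contDiff_succ_iff_hasFDerivAt.1 hF
    have hP : ContDiff ℝ n (pointwiseApply (K := K) E G) := ContinuousLinearMap.contDiff _
    exact contDiff_succ_iff_hasFDerivAt.2
      ⟨fun γ => pointwiseApply E G ((⟨F', hF'.continuous⟩ : C(E, E →L[ℝ] G)).comp γ),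
        hP.comp (ih ⟨F', hF'.continuous⟩ hF'),
        hasFDerivAt_postcomp F ⟨F', hF'.continuous⟩ hd⟩

end PostComp

/-! ### The Picard map on paths and its derivative -/

variable {E : Type*} [NormedAddCommGroup E] [NormedSpace ℝ E]

theorem contDiff_postcomp {K : Type*} [TopologicalSpace K] [CompactSpace K] (F : C(E, E))
    (hF : ContDiff ℝ ∞ F) : ContDiff ℝ ∞ (fun γ : C(K, E) => F.comp γ) :=
  contDiff_infty.2 fun n => contDiff_postcomp_nat n F (contDiff_infty.1 hF n)

/-- The space of paths in `E` parametrized by the unit interval. -/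
abbrev UnitPath (E : Type*) [TopologicalSpace E] := C(Icc (0 : ℝ) 1, E)

/-- The extension of a path to the real line by constants. -/
def ext (γ : UnitPath E) (t : ℝ) : E := γ (projIcc 0 1 zero_le_one t)

omit [NormedSpace ℝ E] in
lemma continuous_ext (γ : UnitPath E) : Continuous (ext γ) :=
  γ.continuous.comp continuous_projIcc

omit [NormedSpace ℝ E] in
lemma ext_of_mem (γ : UnitPath E) {t : ℝ} (ht : t ∈ Icc (0 : ℝ) 1) : ext γ t = γ ⟨t, ht⟩ := by
  simp [ext, projIcc_of_mem zero_le_one ht]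

omit [NormedSpace ℝ E] in
lemma norm_ext_le (γ : UnitPath E) (t : ℝ) : ‖ext γ t‖ ≤ ‖γ‖ := γ.norm_coe_le_norm _

/-- The primitive of a path vanishing at the origin. -/
def primitive : UnitPath E →L[ℝ] UnitPath E :=
  LinearMap.mkContinuous
    { toFun := fun γ => ⟨fun t => ∫ s in (0 : ℝ)..t, ext γ s,
        (intervalIntegral.continuous_primitive
          (fun _ _ => (continuous_ext γ).intervalIntegrable _ _) 0).comp continuous_subtype_val⟩
      map_add' := by
        intro γ η
        ext t
        exact intervalIntegral.integral_add ((continuous_ext γ).intervalIntegrable _ _)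
          ((continuous_ext η).intervalIntegrable _ _)
      map_smul' := by
        intro c γ
        ext t
        exact intervalIntegral.integral_smul c (ext γ) } 1 (by
    intro γ
    rw [one_mul]
    refine (ContinuousMap.norm_le _ (norm_nonneg _)).2 fun t => ?_
    have := intervalIntegral.norm_integral_le_of_norm_le_const (a := (0 : ℝ)) (b := t)
      (f := ext γ) (C := ‖γ‖) fun s _ => norm_ext_le γ s
    refine this.trans (mul_le_of_le_one_right (norm_nonneg _) ?_)
    rw [sub_zero, abs_of_nonneg t.2.1]
    exact t.2.2)

/-- The constant paths. -/
def constPath : E →L[ℝ] UnitPath E :=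
  LinearMap.mkContinuous
    { toFun := fun x => ContinuousMap.const _ x
      map_add' := fun _ _ => rfl
      map_smul' := fun _ _ => rfl } 1 fun x => by
    rw [one_mul]
    exact (ContinuousMap.norm_le _ (norm_nonneg _)).2 fun _ => le_rfl

/-- The map whose zeros in the last component are the solutions `γ` of `γ' = τ F(γ)`, `γ 0 = x`. -/
def picardMap (F : C(E, E)) (z : E × ℝ × UnitPath E) : E × ℝ × UnitPath E :=
  (z.1, z.2.1, z.2.2 - constPath z.1 - z.2.1 • primitive (F.comp z.2.2))

lemma contDiff_picardMap (F : C(E, E)) (hF : ContDiff ℝ ∞ F) : ContDiff ℝ ∞ (picardMap F) := by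
  have h := contDiff_postcomp (K := Icc (0 : ℝ) 1) F hF
  have h3 : ContDiff ℝ ∞ fun z : E × ℝ × UnitPath E => z.2.2 := contDiff_snd.comp contDiff_snd
  have h2 : ContDiff ℝ ∞ fun z : E × ℝ × UnitPath E => z.2.1 := contDiff_fst.comp contDiff_snd
  have hc : ContDiff ℝ ∞ fun z : E × ℝ × UnitPath E => constPath z.1 :=
    (constPath (E := E)).contDiff.comp contDiff_fst
  have hP : ContDiff ℝ ∞ fun z : E × ℝ × UnitPath E => primitive (F.comp z.2.2) :=
    (primitive (E := E)).contDiff.comp (h.comp h3)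
  exact contDiff_fst.prodMk (h2.prodMk ((h3.sub hc).sub (h2.smul hP)))

/-- The shear `(a, s, h) ↦ (a, s, h - a - s w)`. -/
def shear (w : UnitPath E) : (E × ℝ × UnitPath E) ≃L[ℝ] (E × ℝ × UnitPath E) :=
  let p1 := ContinuousLinearMap.fst ℝ E (ℝ × UnitPath E)
  let p2 := (ContinuousLinearMap.fst ℝ ℝ (UnitPath E)).comp (ContinuousLinearMap.snd ℝ E (ℝ × UnitPath E))
  let p3 := (ContinuousLinearMap.snd ℝ ℝ (UnitPath E)).comp (ContinuousLinearMap.snd ℝ E (ℝ × UnitPath E))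
  ContinuousLinearEquiv.equivOfInverse
    (p1.prod (p2.prod (p3 - constPath.comp p1 - p2.smulRight w)))
    (p1.prod (p2.prod (p3 + constPath.comp p1 + p2.smulRight w)))
    (fun z => by
      simp only [p1, p2, p3, ContinuousLinearMap.prod_apply, add_apply,
        sub_apply, ContinuousLinearMap.comp_apply,
        ContinuousLinearMap.smulRight_apply, ContinuousLinearMap.coe_fst',
        ContinuousLinearMap.coe_snd']
      exact Prod.ext rfl (Prod.ext rfl (by dsimp only; abel)))
    (fun z => by
      simp only [p1, p2, p3, ContinuousLinearMap.prod_apply, add_apply,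
        sub_apply, ContinuousLinearMap.comp_apply,
        ContinuousLinearMap.smulRight_apply, ContinuousLinearMap.coe_fst',
        ContinuousLinearMap.coe_snd']
      exact Prod.ext rfl (Prod.ext rfl (by dsimp only; abel)))

/-- At τ = 0 the variation of the integral term with respect to the path disappears, so the
derivative is a shear, invertible without any smallness or Lipschitz estimate. -/
lemma hasFDerivAt_picardMap (F : C(E, E)) (hF : ContDiff ℝ ∞ F) (x₀ : E) :
    HasFDerivAt (picardMap F)
      (shear (primitive (F.comp (constPath x₀))) : (E × ℝ × UnitPath E) →L[ℝ] (E × ℝ × UnitPath E))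
      (x₀, 0, constPath x₀) := by
  have h := ((contDiff_postcomp (K := Icc (0 : ℝ) 1) F hF).differentiable
    (by simp) (constPath x₀)).hasFDerivAt
  have h3 : HasFDerivAt (fun z : E × ℝ × UnitPath E => z.2.2) _ (x₀, 0, constPath x₀) :=
    (hasFDerivAt_snd (𝕜 := ℝ)).comp (x₀, (0 : ℝ), constPath x₀) (hasFDerivAt_snd (𝕜 := ℝ))
  have h2 : HasFDerivAt (fun z : E × ℝ × UnitPath E => z.2.1) _ (x₀, 0, constPath x₀) :=
    (hasFDerivAt_fst (𝕜 := ℝ)).comp (x₀, (0 : ℝ), constPath x₀) (hasFDerivAt_snd (𝕜 := ℝ))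
  have h1 : HasFDerivAt (fun z : E × ℝ × UnitPath E => z.1) _ (x₀, 0, constPath x₀) :=
    hasFDerivAt_fst (𝕜 := ℝ)
  have hF : HasFDerivAt (fun z : E × ℝ × UnitPath E => F.comp z.2.2) _ (x₀, 0, constPath x₀) :=
    HasFDerivAt.comp (g := fun γ : UnitPath E => F.comp γ) (x₀, (0 : ℝ), constPath x₀) h h3
  have hP : HasFDerivAt (fun z : E × ℝ × UnitPath E => primitive (F.comp z.2.2)) _
      (x₀, 0, constPath x₀) :=
    (primitive (E := E)).hasFDerivAt.comp (x₀, (0 : ℝ), constPath x₀) hF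
  have hc : HasFDerivAt (fun z : E × ℝ × UnitPath E => constPath z.1) _ (x₀, 0, constPath x₀) :=
    (constPath (E := E)).hasFDerivAt.comp (x₀, (0 : ℝ), constPath x₀) h1
  refine (h1.prodMk (h2.prodMk ((h3.sub hc).sub (h2.smul hP)))).congr_fderiv ?_
  ext z <;> simp [shear]

end SmoothFlow

end

/-! ### Smooth flows of globally defined vector fields -/

noncomputable section

namespace SmoothFlow

variable {E : Type*} [NormedAddCommGroup E] [NormedSpace ℝ E]

/-- `γ` solves `γ' = τ F(γ)`, `γ 0 = x`, in integral form. -/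
def IsSolution (F : C(E, E)) (z : E × ℝ) (γ : UnitPath E) : Prop :=
  γ - constPath z.1 - z.2 • primitive (F.comp γ) = 0

lemma isSolution_iff (F : C(E, E)) (z : E × ℝ) (γ : UnitPath E) :
    IsSolution F z γ ↔ ∀ t : Icc (0 : ℝ) 1, γ t = z.1 + z.2 • ∫ s in (0 : ℝ)..t, F (ext γ s) := by
  unfold IsSolution
  constructor
  · intro h t
    have := DFunLike.congr_fun h t
    simp only [ContinuousMap.sub_apply, ContinuousMap.zero_apply, sub_sub, sub_eq_zero] at this
    exact this
  · intro h
    ext t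
    simp only [ContinuousMap.sub_apply, ContinuousMap.zero_apply, sub_sub, sub_eq_zero]
    exact h t

/-- The inverse function theorem for `picardMap` at the constant path: the family is the path
component of the local inverse on the slice with last entry 0. The final clause, local uniqueness,
is what later relates solutions of different speeds. -/
lemma exists_solution_family [CompleteSpace E] (F : C(E, E)) (hF : ContDiff ℝ ∞ F) (x₀ : E) :
    ∃ Γ : E × ℝ → UnitPath E, Γ (x₀, 0) = constPath x₀ ∧
      (∀ᶠ z in 𝓝 (x₀, (0 : ℝ)), ContDiffAt ℝ ∞ Γ z) ∧
      (∀ᶠ z in 𝓝 (x₀, (0 : ℝ)), IsSolution F z (Γ z)) ∧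
      ∀ᶠ p in 𝓝 ((x₀, (0 : ℝ)), constPath x₀), IsSolution F p.1 p.2 → p.2 = Γ p.1 := by
  have hsm := contDiff_picardMap F hF
  let Ψ := hsm.contDiffAt.toOpenPartialHomeomorph (picardMap F) (hasFDerivAt_picardMap F hF x₀)
    (by simp)
  have hΨ : ∀ z, Ψ z = picardMap F z := fun _ => rfl
  have hsrc : (x₀, (0 : ℝ), constPath x₀) ∈ Ψ.source :=
    hsm.contDiffAt.mem_toOpenPartialHomeomorph_source (hasFDerivAt_picardMap F hF x₀) (by simp)
  have hval : Ψ (x₀, (0 : ℝ), constPath x₀) = (x₀, 0, 0) := by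
    simp [hΨ, picardMap]
  have htgt : (x₀, (0 : ℝ), (0 : UnitPath E)) ∈ Ψ.target := hval ▸ Ψ.map_source hsrc
  have hsymm : Ψ.symm (x₀, (0 : ℝ), (0 : UnitPath E)) = (x₀, 0, constPath x₀) := by
    rw [← hval, Ψ.left_inv hsrc]
  let ι : E × ℝ → E × ℝ × UnitPath E := fun z => (z.1, z.2, 0)
  have hι : ContDiff ℝ ∞ ι := contDiff_fst.prodMk (contDiff_snd.prodMk contDiff_const)
  have hιt : ∀ᶠ z in 𝓝 (x₀, (0 : ℝ)), ι z ∈ Ψ.target :=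
    hι.continuous.continuousAt.eventually (Ψ.open_target.mem_nhds htgt)
  refine ⟨fun z => (Ψ.symm (ι z)).2.2, ?_, ?_, ?_, ?_⟩
  · simp [ι, hsymm]
  -- Smoothness is needed on a whole neighbourhood, not only at the base point; it holds because
  -- invertibility of the derivative is an open condition.
  · have hcont : ContinuousAt (fun z => fderiv ℝ (picardMap F) (Ψ.symm (ι z))) (x₀, (0 : ℝ)) := by
      refine ((hsm.continuous_fderiv (by simp)).continuousAt).comp ?_
      exact ContinuousAt.comp (g := Ψ.symm) (Ψ.symm.continuousAt htgt) hι.continuous.continuousAt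
    have hev := hcont.eventually (p := fun L => L ∈ range ContinuousLinearEquiv.toContinuousLinearMap)
      (by
        simp only [ι, hsymm]
        rw [(hasFDerivAt_picardMap F hF x₀).fderiv]
        exact ContinuousLinearEquiv.nhds _)
    filter_upwards [hιt, hev] with z hz ⟨e, he⟩
    have h1 : ContDiffAt ℝ ∞ Ψ.symm (ι z) := by
      refine Ψ.contDiffAt_symm (f₀' := e) hz ?_ hsm.contDiffAt
      rw [he]
      exact (hsm.differentiable (by simp) _).hasFDerivAt
    exact (contDiff_snd.comp contDiff_snd).contDiffAt.comp z (h1.comp z hι.contDiffAt)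
  · filter_upwards [hιt] with z hz
    have h := Ψ.right_inv hz
    rw [hΨ] at h
    simp only [picardMap, ι, Prod.mk.injEq] at h
    obtain ⟨h1, h2, h3⟩ := h
    rw [h1, h2] at h3
    exact h3
  · have hc : Continuous fun p : (E × ℝ) × UnitPath E => (p.1.1, p.1.2, p.2) := by fun_prop
    have := (hc.continuousAt (x := ((x₀, (0 : ℝ)), constPath x₀))).eventually
      (Ψ.open_source.mem_nhds hsrc)
    filter_upwards [this] with p hp hsol
    have h : Ψ (p.1.1, p.1.2, p.2) = ι p.1 := by
      rw [hΨ]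
      exact Prod.ext rfl (Prod.ext rfl hsol)
    change p.2 = (Ψ.symm (ι p.1)).2.2
    rw [← h, Ψ.left_inv hp]

/-- The path `r ↦ γ (s r)`. -/
def slowDown (s : Icc (0 : ℝ) 1) (γ : UnitPath E) : UnitPath E :=
  ⟨fun r => γ (s * r), by fun_prop⟩

/-- The substitution q ↦ s q in the integral trades slower travel for a smaller speed parameter. -/
lemma IsSolution.slowDown {F : C(E, E)} {z : E × ℝ} {γ : UnitPath E} (h : IsSolution F z γ)
    (s : Icc (0 : ℝ) 1) : IsSolution F (z.1, s * z.2) (slowDown s γ) := by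
  rw [isSolution_iff] at h ⊢
  intro t
  have h1 := h (s * t)
  change γ (s * t) = _
  rw [h1]
  have h2 := intervalIntegral.smul_integral_comp_mul_left (a := 0) (b := (t : ℝ))
    (fun q => F (ext γ q)) (s : ℝ)
  rw [mul_zero] at h2
  have h3 : ((s * t : Icc (0 : ℝ) 1) : ℝ) = s * t := rfl
  dsimp only
  rw [h3, ← h2, mul_comm (s : ℝ) z.2, mul_smul]
  congr 3
  refine intervalIntegral.integral_congr fun q hq => ?_
  rw [uIcc_of_le t.2.1] at hq
  have hq' : q ∈ Icc (0 : ℝ) 1 := ⟨hq.1, hq.2.trans t.2.2⟩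
  have hsq : (s : ℝ) * q ∈ Icc (0 : ℝ) 1 :=
    ⟨mul_nonneg s.2.1 hq'.1, mul_le_one₀ s.2.2 hq'.1 hq'.2⟩
  change F _ = F _
  rw [ext_of_mem _ hq', ext_of_mem _ hsq]
  rfl

/-- A globally smooth vector field has a smooth local flow. -/
theorem exists_smooth_flow [CompleteSpace E] (F : E → E) (hF : ContDiff ℝ ∞ F) (x₀ : E) :
    ∃ ε > 0, ∃ φ : E × ℝ → E, ContDiffOn ℝ ∞ φ (Metric.ball (x₀, 0) ε) ∧
      (∀ x ∈ Metric.ball x₀ ε, φ (x, 0) = x) ∧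
      ∀ z ∈ Metric.ball (x₀, (0 : ℝ)) ε, HasDerivAt (fun t => φ (z.1, t)) (F (φ z)) z.2 := by
  let F' : C(E, E) := ⟨F, hF.continuous⟩
  obtain ⟨Γ, h0, hsm, hsol, huniq⟩ := exists_solution_family F' hF x₀
  obtain ⟨ρ, hρ, huniq⟩ := Metric.eventually_nhds_iff_ball.1 huniq
  have hclose : ∀ᶠ z in 𝓝 (x₀, (0 : ℝ)), dist (Γ z) (constPath x₀) < ρ := by
    have := hsm.self_of_nhds.continuousAt.eventually (Metric.ball_mem_nhds _ hρ)
    simpa [h0] using this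
  obtain ⟨ε, hε, H⟩ := Metric.eventually_nhds_iff_ball.1
    ((hsm.and hsol).and (hclose.and (Metric.ball_mem_nhds (x₀, (0 : ℝ)) hρ)))
  let one : Icc (0 : ℝ) 1 := ⟨1, by simp⟩
  -- The flow at time t is the endpoint of the unit-time solution with speed t.
  let φ : E × ℝ → E := fun z => Γ z one
  have hball : ∀ x t, (x, t) ∈ Metric.ball (x₀, (0 : ℝ)) ε ↔ dist x x₀ < ε ∧ |t| < ε := by
    intro x t
    simp [Prod.dist_eq]
  -- The slowed path stays as close to the constant path as the original, so local uniqueness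
  -- identifies it with the solution of speed s t. This turns the speed parameter into actual time.
  have hscale : ∀ z ∈ Metric.ball (x₀, (0 : ℝ)) ε, ∀ s : Icc (0 : ℝ) 1,
      φ (z.1, s * z.2) = Γ z s := by
    rintro ⟨x, t⟩ hz s
    have hz' : (x, (s : ℝ) * t) ∈ Metric.ball (x₀, (0 : ℝ)) ε := by
      rw [hball] at hz ⊢
      refine ⟨hz.1, ?_⟩
      rw [abs_mul, abs_of_nonneg s.2.1]
      exact (mul_le_of_le_one_left (abs_nonneg t) s.2.2).trans_lt hz.2
    have hs : IsSolution F' (x, (s : ℝ) * t) (slowDown s (Γ (x, t))) := (H _ hz).1.2.slowDown s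
    have hd : dist (slowDown s (Γ (x, t))) (constPath x₀) < ρ :=
      lt_of_le_of_lt ((ContinuousMap.dist_le dist_nonneg).2 fun r =>
        ContinuousMap.dist_apply_le_dist (f := Γ (x, t)) (g := constPath x₀) (s * r)) (H _ hz).2.1
    have hmem : ((x, (s : ℝ) * t), slowDown s (Γ (x, t))) ∈
        Metric.ball ((x₀, (0 : ℝ)), constPath x₀) ρ := by
      rw [Metric.mem_ball, Prod.dist_eq]
      exact max_lt (H _ hz').2.2 hd
    have h1 := huniq _ hmem hs
    change Γ (x, (s : ℝ) * t) one = _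
    rw [← h1]
    change Γ (x, t) (s * one) = _
    congr 1
    exact mul_one s
  have hint : ∀ z ∈ Metric.ball (x₀, (0 : ℝ)) ε,
      φ z = z.1 + ∫ s in (0 : ℝ)..z.2, F (φ (z.1, s)) := by
    rintro ⟨x, t⟩ hz
    have h1 := (isSolution_iff _ _ _).1 (H _ hz).1.2 one
    change φ (x, t) = x + t • ∫ s in (0 : ℝ)..1, F (ext (Γ (x, t)) s) at h1
    rw [h1]
    have h2 := intervalIntegral.smul_integral_comp_mul_left (a := 0) (b := 1)
      (fun s => F (φ (x, s))) t
    rw [mul_zero, mul_one] at h2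
    dsimp only
    rw [← h2]
    congr 2
    refine intervalIntegral.integral_congr fun q hq => ?_
    rw [uIcc_of_le zero_le_one] at hq
    have h3 := hscale _ hz ⟨q, hq⟩
    dsimp only at h3 ⊢
    rw [ext_of_mem _ hq, ← h3, mul_comm]
  have hev : ContDiff ℝ ∞ (ContinuousMap.evalCLM ℝ one : UnitPath E →L[ℝ] E) :=
    ContinuousLinearMap.contDiff _
  have hsmφ : ContDiffOn ℝ ∞ φ (Metric.ball (x₀, 0) ε) := fun z hz =>
    (hev.contDiffAt.comp z (H z hz).1.1).contDiffWithinAt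
  refine ⟨ε, hε, φ, hsmφ, ?_, ?_⟩
  · intro x hx
    simpa using hint (x, 0) ((hball _ _).2 ⟨hx, by simpa using hε⟩)
  · rintro ⟨x, t⟩ hz
    have hx := ((hball _ _).1 hz).1
    have hcont : ContinuousOn (fun s => F (φ (x, s))) (Metric.ball 0 ε) := by
      refine hF.continuous.comp_continuousOn (hsmφ.continuousOn.comp (by fun_prop) ?_)
      intro s hs
      exact (hball _ _).2 ⟨hx, by simpa using hs⟩
    have ht : t ∈ Metric.ball (0 : ℝ) ε := by simpa using ((hball _ _).1 hz).2
    have h0 : (0 : ℝ) ∈ Metric.ball (0 : ℝ) ε := Metric.mem_ball_self hε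
    have hii : IntervalIntegrable (fun s => F (φ (x, s))) MeasureTheory.volume 0 t := by
      refine (hcont.mono ?_).intervalIntegrable
      exact (convex_ball (0 : ℝ) ε).ordConnected.uIcc_subset h0 ht
    have hd := intervalIntegral.integral_hasDerivAt_right hii
      (hcont.stronglyMeasurableAtFilter Metric.isOpen_ball t ht)
      (hcont.continuousAt (Metric.isOpen_ball.mem_nhds ht))
    refine (hd.const_add x).congr_of_eventuallyEq ?_
    filter_upwards [Metric.isOpen_ball.mem_nhds ht] with s hs
    exact hint (x, s) ((hball _ _).2 ⟨hx, by simpa using hs⟩)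

end SmoothFlow

end

/-! ### Flows on open sets and parametrizations by flow lines -/

noncomputable section

namespace SmoothFlow

variable {E : Type*} [NormedAddCommGroup E] [NormedSpace ℝ E] [FiniteDimensional ℝ E]

/-- A bump function cuts the field off inside Ω, so that the flow theorem for global fields applies.
-/
lemma exists_contDiff_eventuallyEq {G : E → E} {Ω : Set E} (hΩ : IsOpen Ω)
    (hG : ContDiffOn ℝ ∞ G Ω) {e₀ : E} (he₀ : e₀ ∈ Ω) :
    ∃ F : E → E, ContDiff ℝ ∞ F ∧ F =ᶠ[𝓝 e₀] G := by
  obtain ⟨ρ, hρ, hsub⟩ := Metric.isOpen_iff.1 hΩ e₀ he₀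
  let χ : ContDiffBump e₀ := ⟨ρ / 4, ρ / 2, by positivity, by linarith⟩
  refine ⟨fun x => χ x • G x, ?_, ?_⟩
  · rw [contDiff_iff_contDiffAt]
    intro x
    by_cases hx : x ∈ Ω
    · exact χ.contDiff.contDiffAt.smul (hG.contDiffAt (hΩ.mem_nhds hx))
    · have hx' : x ∉ tsupport χ := by
        rw [χ.tsupport_eq]
        intro h
        refine hx (hsub ?_)
        exact Metric.closedBall_subset_ball (by change ρ / 2 < ρ; linarith) h
      have h0 : (fun x => χ x • G x) =ᶠ[𝓝 x] fun _ => 0 := by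
        filter_upwards [notMem_tsupport_iff_eventuallyEq.1 hx'] with y hy
        simp [hy]
      exact contDiffAt_const.congr_of_eventuallyEq h0
  · filter_upwards [χ.eventuallyEq_one] with x hx
    simp [hx]

/-- A smooth vector field on an open set has a smooth local flow. -/
theorem exists_smooth_flow_on {G : E → E} {Ω : Set E} (hΩ : IsOpen Ω)
    (hG : ContDiffOn ℝ ∞ G Ω) {e₀ : E} (he₀ : e₀ ∈ Ω) :
    ∃ ε > 0, ∃ φ : E × ℝ → E, ContDiffOn ℝ ∞ φ (Metric.ball (e₀, 0) ε) ∧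
      (∀ x ∈ Metric.ball e₀ ε, φ (x, 0) = x) ∧
      MapsTo φ (Metric.ball (e₀, (0 : ℝ)) ε) Ω ∧
      ∀ z ∈ Metric.ball (e₀, (0 : ℝ)) ε, HasDerivAt (fun t => φ (z.1, t)) (G (φ z)) z.2 := by
  obtain ⟨F, hF, hFG⟩ := exists_contDiff_eventuallyEq hΩ hG he₀
  obtain ⟨ε, hε, φ, hφ, hφ0, hφd⟩ := exists_smooth_flow F hF e₀
  have hmem : (e₀, (0 : ℝ)) ∈ Metric.ball (e₀, (0 : ℝ)) ε := Metric.mem_ball_self hε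
  have hc : ContinuousAt φ (e₀, 0) :=
    hφ.continuousOn.continuousAt (Metric.isOpen_ball.mem_nhds hmem)
  have h0 : φ (e₀, 0) = e₀ := hφ0 e₀ (Metric.mem_ball_self hε)
  have hev := hc.eventually (p := fun y => F y = G y ∧ y ∈ Ω)
    (by rw [h0]; exact hFG.and (hΩ.mem_nhds he₀))
  obtain ⟨ε', hε', H⟩ := Metric.eventually_nhds_iff_ball.1 hev
  have hb : Metric.ball (e₀, (0 : ℝ)) (min ε ε') ⊆ Metric.ball (e₀, (0 : ℝ)) ε :=
    Metric.ball_subset_ball (min_le_left _ _)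
  have hb' : Metric.ball (e₀, (0 : ℝ)) (min ε ε') ⊆ Metric.ball (e₀, (0 : ℝ)) ε' :=
    Metric.ball_subset_ball (min_le_right _ _)
  refine ⟨min ε ε', lt_min hε hε', φ, hφ.mono hb,
    fun x hx => hφ0 x (Metric.ball_subset_ball (min_le_left _ _) hx),
    fun z hz => (H z (hb' hz)).2, fun z hz => ?_⟩
  rw [← (H z (hb' hz)).1]
  exact hφd z (hb hz)

/-- The flow lines through a transverse segment, projected to a plane by `pr`, form an injective
immersed family of curves. -/
theorem exists_flow_parametrization {P : Type*} [NormedAddCommGroup P] [NormedSpace ℝ P]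
    (hP : Module.finrank ℝ P = 2) {G : E → E} {Ω : Set E} (hΩ : IsOpen Ω)
    (hG : ContDiffOn ℝ ∞ G Ω) {e₀ : E} (he₀ : e₀ ∈ Ω) (pr : E →L[ℝ] P) (d : E)
    (hind : LinearIndependent ℝ ![pr d, pr (G e₀)]) :
    ∃ δ > 0, ∃ ψ : ℝ × ℝ → E, ψ (0, 0) = e₀ ∧
      ContDiffOn ℝ ∞ ψ (Ioo (-δ) δ ×ˢ Ioo (-δ) δ) ∧
      MapsTo ψ (Ioo (-δ) δ ×ˢ Ioo (-δ) δ) Ω ∧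
      (∀ z ∈ Ioo (-δ) δ ×ˢ Ioo (-δ) δ, HasDerivAt (fun s => ψ (z.1, s)) (G (ψ z)) z.2) ∧
      InjOn (fun z => pr (ψ z)) (Ioo (-δ) δ ×ˢ Ioo (-δ) δ) ∧
      ∀ z ∈ Ioo (-δ) δ ×ˢ Ioo (-δ) δ,
        Function.Injective (fderiv ℝ (fun z => pr (ψ z)) z) := by
  have : FiniteDimensional ℝ P := Module.finite_of_finrank_eq_succ hP
  obtain ⟨ε, hε, φ, hφ, hφ0, hφΩ, hφd⟩ := exists_smooth_flow_on hΩ hG he₀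
  let ι : ℝ × ℝ → E × ℝ := fun z => (e₀ + z.1 • d, z.2)
  have hι : ContDiff ℝ ∞ ι := by fun_prop
  have hι0 : ι (0, 0) = (e₀, 0) := by simp [ι]
  -- Start at e₀ + u d and flow for time v.
  let ψ : ℝ × ℝ → E := fun z => φ (ι z)
  have hballev : ∀ᶠ z in 𝓝 ((0 : ℝ), (0 : ℝ)), ι z ∈ Metric.ball (e₀, (0 : ℝ)) ε :=
    hι.continuous.continuousAt.eventually (by rw [hι0]; exact Metric.ball_mem_nhds _ hε)
  have hsm : ∀ z, ι z ∈ Metric.ball (e₀, (0 : ℝ)) ε → ContDiffAt ℝ ∞ ψ z := fun z hz =>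
    (hφ.contDiffAt (Metric.isOpen_ball.mem_nhds hz)).comp z hι.contDiffAt
  have hψ0 : ψ (0, 0) = e₀ := by
    change φ (ι (0, 0)) = e₀
    rw [hι0]
    exact hφ0 e₀ (Metric.mem_ball_self hε)
  have hmem0 : ι (0, 0) ∈ Metric.ball (e₀, (0 : ℝ)) ε := hballev.self_of_nhds
  have hY : ContDiffAt ℝ ∞ (fun z => pr (ψ z)) (0, 0) :=
    pr.contDiff.contDiffAt.comp (0, 0) (hsm _ hmem0)
  set L := fderiv ℝ (fun z => pr (ψ z)) ((0 : ℝ), (0 : ℝ)) with hL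
  have hYd : HasFDerivAt (fun z => pr (ψ z)) L (0, 0) :=
    (hY.differentiableAt (by simp)).hasFDerivAt
  have hLv : L (0, 1) = pr (G e₀) := by
    have h1 : HasDerivAt (fun s : ℝ => ((0 : ℝ), s)) ((0 : ℝ), (1 : ℝ)) 0 :=
      (hasDerivAt_const 0 (0 : ℝ)).prodMk (hasDerivAt_id 0)
    have h2 := HasFDerivAt.comp_hasDerivAt (x := (0 : ℝ)) (f := fun s : ℝ => ((0 : ℝ), s)) hYd h1
    have h3 := hφd _ hmem0
    have h4 := pr.hasFDerivAt.comp_hasDerivAt (0 : ℝ) h3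
    have h5 := h2.unique h4
    rw [h5]
    exact congrArg (fun e => pr (G e)) hψ0
  have hLu : L (1, 0) = pr d := by
    have h1 : HasDerivAt (fun s : ℝ => (s, (0 : ℝ))) ((1 : ℝ), (0 : ℝ)) 0 :=
      (hasDerivAt_id 0).prodMk (hasDerivAt_const 0 (0 : ℝ))
    have h2 := HasFDerivAt.comp_hasDerivAt (x := (0 : ℝ)) (f := fun s : ℝ => (s, (0 : ℝ))) hYd h1
    have h3 : HasDerivAt (fun s : ℝ => pr (e₀ + s • d)) (pr d) 0 := by
      have h4 : HasDerivAt (fun s : ℝ => e₀ + s • d) d 0 := by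
        simpa using ((hasDerivAt_id (0 : ℝ)).smul_const d).const_add e₀
      exact pr.hasFDerivAt.comp_hasDerivAt (0 : ℝ) h4
    refine h2.unique (h3.congr_of_eventuallyEq ?_)
    have hc : ContinuousAt (fun s : ℝ => e₀ + s • d) 0 := by fun_prop
    have hev := hc.eventually (p := fun y => y ∈ Metric.ball e₀ ε)
      (by simp only [zero_smul, add_zero]; exact Metric.ball_mem_nhds e₀ hε)
    filter_upwards [hev] with s hs
    exact congrArg pr (hφ0 _ hs)
  -- The derivative at the origin sends the standard basis to `pr d` and `pr (G e₀)`. Their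
  -- independence gives local injectivity by the inverse function theorem, and the immersion
  -- property persists nearby by openness.
  have hLinj : Function.Injective L := by
    rw [injective_iff_map_eq_zero]
    rintro ⟨a, b⟩ hab
    have h1 : L (a, b) = a • pr d + b • pr (G e₀) := by
      have : ((a, b) : ℝ × ℝ) = a • (1, 0) + b • (0, 1) := by simp
      rw [this, map_add, map_smul, map_smul, hLu, hLv]
    obtain ⟨ha, hb⟩ := LinearIndependent.pair_iff.1 hind a b (h1 ▸ hab)
    rw [ha, hb]
    rfl
  let e : (ℝ × ℝ) ≃L[ℝ] P :=
    (LinearEquiv.ofInjectiveOfFinrankEq (L : ℝ × ℝ →ₗ[ℝ] P) hLinj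
      (by simp [hP])).toContinuousLinearEquiv
  have heL : (e : (ℝ × ℝ) →L[ℝ] P) = L := by
    ext1 <;> rfl
  have hstrict : HasStrictFDerivAt (fun z => pr (ψ z)) (e : (ℝ × ℝ) →L[ℝ] P) (0, 0) := by
    rw [heL]
    exact hY.hasStrictFDerivAt (by simp)
  have hinj : ∃ s ∈ 𝓝 ((0 : ℝ), (0 : ℝ)), InjOn (fun z => pr (ψ z)) s :=
    ⟨_, hstrict.toOpenPartialHomeomorph.open_source.mem_nhds
      hstrict.mem_toOpenPartialHomeomorph_source, hstrict.toOpenPartialHomeomorph.injOn⟩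
  obtain ⟨s, hs, hsinj⟩ := hinj
  have himm : ∀ᶠ z in 𝓝 ((0 : ℝ), (0 : ℝ)),
      Function.Injective (fderiv ℝ (fun z => pr (ψ z)) z) := by
    have hc : ContinuousAt (fderiv ℝ (fun z => pr (ψ z))) (0, 0) :=
      (hY.fderiv_right (m := 0) (by simp)).continuousAt
    exact hc.eventually (ContinuousLinearMap.isOpen_injective.mem_nhds hLinj)
  obtain ⟨δ, hδ, H⟩ := Metric.eventually_nhds_iff_ball.1 (hballev.and (himm.and hs))
  have hsq : Ioo (-δ) δ ×ˢ Ioo (-δ) δ ⊆ Metric.ball ((0 : ℝ), (0 : ℝ)) δ := by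
    rintro ⟨u, v⟩ ⟨hu, hv⟩
    rw [Metric.mem_ball, Prod.dist_eq]
    simp only [dist_zero_right, Real.norm_eq_abs]
    exact max_lt (abs_lt.2 hu) (abs_lt.2 hv)
  refine ⟨δ, hδ, ψ, hψ0, fun z hz => (hsm z (H z (hsq hz)).1).contDiffWithinAt,
    fun z hz => hφΩ (H z (hsq hz)).1, fun z hz => hφd _ (H z (hsq hz)).1,
    hsinj.mono fun z hz => (H z (hsq hz)).2.2, fun z hz => (H z (hsq hz)).2.1⟩

end SmoothFlow

end

/-! ### Christoffel symbols and the metric in a chart -/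

noncomputable section

namespace ConstAngle

section Calculus

lemma exists_koszul_linear {E : Type*} [NormedAddCommGroup E] [NormedSpace ℝ E]
    (D : E →L[ℝ] E →L[ℝ] E →L[ℝ] ℝ) (a b : E) :
    ∃ l : E →ₗ[ℝ] ℝ, ∀ c, l c = (1 / 2 : ℝ) * (D a b c + D b a c - D c a b) :=
  ⟨(1 / 2 : ℝ) • ((D a b + D b a : E →L[ℝ] ℝ).toLinearMap - ((D.flip a).flip b).toLinearMap),
    fun _ => rfl⟩

variable {E : Type*} [NormedAddCommGroup E] [NormedSpace ℝ E]
  {M : Type*} [TopologicalSpace M] [ChartedSpace E M] [IsManifold 𝓘(ℝ, E) ∞ M]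

lemma fieldCoords_eq {N : Type*} (x₀ : M) (g : N → M) (W : ∀ q, TangentSpace 𝓘(ℝ, E) (g q)) (q : N)
    (hq : g q ∈ (chartAt E x₀).source) :
    fieldCoords x₀ g W q =
      (trivializationAt E (TangentSpace 𝓘(ℝ, E)) x₀).continuousLinearMapAt ℝ (g q) (W q) :=
  (Trivialization.continuousLinearMapAt_apply_of_mem ℝ _ (by simpa using hq) _).symm

lemma coordVec_fieldCoords {N : Type*} (x₀ : M) (g : N → M) (W : ∀ q, TangentSpace 𝓘(ℝ, E) (g q))
    (q : N) (hq : g q ∈ (chartAt E x₀).source) :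
    coordVec x₀ (fieldCoords x₀ g W q) (g q) = W q := by
  rw [fieldCoords_eq x₀ g W q hq]
  exact Trivialization.symmL_continuousLinearMapAt _ (by simpa using hq) _

lemma fieldCoords_self {N : Type*} (g : N → M) (W : ∀ q, TangentSpace 𝓘(ℝ, E) (g q)) (q : N) :
    fieldCoords (g q) g W q = coords (g q) (W q) :=
  fieldCoords_eq _ _ _ _ (mem_chart_source E _)

lemma coordVec_coords (x₀ : M) (v : TangentSpace 𝓘(ℝ, E) x₀) :
    coordVec x₀ (coords x₀ v) x₀ = v :=
  Trivialization.symmL_continuousLinearMapAt _ (by simp) _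

variable {F : Type*} [NormedAddCommGroup F] [NormedSpace ℝ F]
  {N : Type*} [TopologicalSpace N] [ChartedSpace F N]

lemma mdifferentiableAt_fieldCoords {g : N → M} {W : ∀ q, TangentSpace 𝓘(ℝ, E) (g q)} {q : N}
    (hW : MDifferentiableAt 𝓘(ℝ, F) (𝓘(ℝ, E).prod 𝓘(ℝ, E))
      (fun q => (⟨g q, W q⟩ : TangentBundle 𝓘(ℝ, E) M)) q) :
    MDifferentiableAt 𝓘(ℝ, F) 𝓘(ℝ, E) (fieldCoords (g q) g W) q :=
  ((mdifferentiableAt_totalSpace _ _).1 hW).2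

lemma mdifferentiableAt_base {g : N → M} {W : ∀ q, TangentSpace 𝓘(ℝ, E) (g q)} {q : N}
    (hW : MDifferentiableAt 𝓘(ℝ, F) (𝓘(ℝ, E).prod 𝓘(ℝ, E))
      (fun q => (⟨g q, W q⟩ : TangentBundle 𝓘(ℝ, E) M)) q) :
    MDifferentiableAt 𝓘(ℝ, F) 𝓘(ℝ, E) g q :=
  ((mdifferentiableAt_totalSpace _ _).1 hW).1

lemma coords_mfderiv {g : N → M} {q : N} (hg : MDifferentiableAt 𝓘(ℝ, F) 𝓘(ℝ, E) g q) {x₀ : M}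
    (hx : g q ∈ (chartAt E x₀).source) (v : TangentSpace 𝓘(ℝ, F) q) :
    (trivializationAt E (TangentSpace 𝓘(ℝ, E)) x₀).continuousLinearMapAt ℝ (g q)
      (mfderiv 𝓘(ℝ, F) 𝓘(ℝ, E) g q v) =
      mvfderiv 𝓘(ℝ, F) (fun q => extChartAt 𝓘(ℝ, E) x₀ (g q)) q v := by
  have : IsManifold 𝓘(ℝ, E) 1 M := IsManifold.of_le (n := ∞) (by simp)
  rw [TangentBundle.continuousLinearMapAt_trivializationAt hx]
  exact (mfderiv_comp_apply q (mdifferentiableAt_extChartAt hx) hg v).symm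

variable [FiniteDimensional ℝ E] [RiemannianBundle (fun x : M => TangentSpace 𝓘(ℝ, E) x)]

omit [FiniteDimensional ℝ E] in
lemma chartMetric_symm (x₀ : M) (a b : E) : chartMetric x₀ a b = chartMetric x₀ b a := by
  funext y
  exact real_inner_comm _ _

/-- The coordinate expression of the metric as a bilinear form. -/
def chartForm (x₀ : M) (y : E) : E →L[ℝ] E →L[ℝ] ℝ :=
  ((innerSL ℝ : TangentSpace 𝓘(ℝ, E) ((extChartAt 𝓘(ℝ, E) x₀).symm y) →L[ℝ]
    TangentSpace 𝓘(ℝ, E) ((extChartAt 𝓘(ℝ, E) x₀).symm y) →L[ℝ] ℝ).bilinearComp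
      ((trivializationAt E (TangentSpace 𝓘(ℝ, E)) x₀).symmL ℝ ((extChartAt 𝓘(ℝ, E) x₀).symm y))
      ((trivializationAt E (TangentSpace 𝓘(ℝ, E)) x₀).symmL ℝ ((extChartAt 𝓘(ℝ, E) x₀).symm y)))

omit [FiniteDimensional ℝ E] in
lemma chartForm_apply (x₀ : M) (y a b : E) : chartForm x₀ y a b = chartMetric x₀ a b y := rfl

omit [FiniteDimensional ℝ E] [TopologicalSpace N] in
-- Expresses the inner product through functions on a fixed chart, where the ordinary product rule
-- is available.
lemma inner_eq_chartForm (x₀ : M) {g : N → M} (W₁ W₂ : ∀ q, TangentSpace 𝓘(ℝ, E) (g q)) (q : N)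
    (hq : g q ∈ (chartAt E x₀).source) :
    inner ℝ (W₁ q) (W₂ q) = chartForm x₀ (extChartAt 𝓘(ℝ, E) x₀ (g q))
      (fieldCoords x₀ g W₁ q) (fieldCoords x₀ g W₂ q) := by
  have h : (extChartAt 𝓘(ℝ, E) x₀).symm (extChartAt 𝓘(ℝ, E) x₀ (g q)) = g q :=
    (extChartAt 𝓘(ℝ, E) x₀).left_inv (by simpa using hq)
  rw [chartForm_apply, chartMetric, h, coordVec_fieldCoords x₀ g W₁ q hq,
    coordVec_fieldCoords x₀ g W₂ q hq]

variable [IsContMDiffRiemannianBundle 𝓘(ℝ, E) ∞ E (fun x : M => TangentSpace 𝓘(ℝ, E) x)]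

omit [FiniteDimensional ℝ E] in
-- Coordinate fields have constant components in the trivialization, hence are smooth sections, and
-- the bundle metric is smooth.
lemma contDiffOn_chartMetric (x₀ : M) (a b : E) :
    ContDiffOn ℝ ∞ (chartMetric x₀ a b) (extChartAt 𝓘(ℝ, E) x₀).target := by
  have hs : ∀ c : E, ContMDiffOn 𝓘(ℝ, E) (𝓘(ℝ, E).prod 𝓘(ℝ, E)) ∞
      (fun y => (⟨(extChartAt 𝓘(ℝ, E) x₀).symm y, coordVec x₀ c ((extChartAt 𝓘(ℝ, E) x₀).symm y)⟩ :
        TangentBundle 𝓘(ℝ, E) M)) (extChartAt 𝓘(ℝ, E) x₀).target := by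
    intro c
    have hb : ∀ y ∈ (extChartAt 𝓘(ℝ, E) x₀).target, (extChartAt 𝓘(ℝ, E) x₀).symm y ∈
        (trivializationAt E (TangentSpace 𝓘(ℝ, E)) x₀).baseSet := by
      intro y hy
      simpa using (extChartAt 𝓘(ℝ, E) x₀).map_target hy
    rw [Trivialization.contMDiffOn_iff (e := trivializationAt E (TangentSpace 𝓘(ℝ, E)) x₀)
      (fun y hy => (Trivialization.mem_source _).2 (hb y hy))]
    refine ⟨contMDiffOn_extChartAt_symm x₀, contMDiffOn_const (c := c) |>.congr fun y hy => ?_⟩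
    rw [coordVec, Trivialization.symmL_apply (R := ℝ) _ (hb y hy), Trivialization.apply_mk_symm _ (hb y hy)]
  exact contMDiffOn_iff_contDiffOn.1 (ContMDiffOn.inner_bundle (IB := 𝓘(ℝ, E))
    (E := fun x : M => TangentSpace 𝓘(ℝ, E) x) (hs a) (hs b))

lemma contDiffOn_chartForm (x₀ : M) :
    ContDiffOn ℝ ∞ (chartForm x₀) (extChartAt 𝓘(ℝ, E) x₀).target :=
  contDiffOn_clm_apply.2 fun a => contDiffOn_clm_apply.2 fun b => contDiffOn_chartMetric x₀ a b

lemma differentiableAt_chartForm (x₀ : M) :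
    DifferentiableAt ℝ (chartForm x₀) (extChartAt 𝓘(ℝ, E) x₀ x₀) :=
  ((contDiffOn_chartForm x₀).contDiffAt
    ((isOpen_extChartAt_target x₀).mem_nhds (mem_extChartAt_target x₀))).differentiableAt (by simp)

lemma fderiv_chartMetric (x₀ : M) (a b c : E) :
    fderiv ℝ (chartMetric x₀ b c) (extChartAt 𝓘(ℝ, E) x₀ x₀) a =
      fderiv ℝ (chartForm x₀) (extChartAt 𝓘(ℝ, E) x₀ x₀) a b c := by
  have h := (differentiableAt_chartForm (E := E) x₀).hasFDerivAt
  have h1 := (h.clm_apply (hasFDerivAt_const b _)).clm_apply (hasFDerivAt_const c _)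
  have h2 : HasFDerivAt (chartMetric x₀ b c) _ (extChartAt 𝓘(ℝ, E) x₀ x₀) := h1
  rw [h2.fderiv]
  simp

lemma fderiv_chartForm_symm (x₀ : M) (a b c : E) :
    fderiv ℝ (chartForm x₀) (extChartAt 𝓘(ℝ, E) x₀ x₀) a b c =
      fderiv ℝ (chartForm x₀) (extChartAt 𝓘(ℝ, E) x₀ x₀) a c b := by
  rw [← fderiv_chartMetric, ← fderiv_chartMetric, chartMetric_symm]

lemma christoffelFirst_eq (x₀ : M) (a b c : E) :
    christoffelFirst x₀ a b c = (1 / 2 : ℝ) *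
      (fderiv ℝ (chartForm x₀) (extChartAt 𝓘(ℝ, E) x₀ x₀) a b c
        + fderiv ℝ (chartForm x₀) (extChartAt 𝓘(ℝ, E) x₀ x₀) b a c
        - fderiv ℝ (chartForm x₀) (extChartAt 𝓘(ℝ, E) x₀ x₀) c a b) := by
  simp only [christoffelFirst, fderiv_chartMetric]

/-- The source of torsion-freeness: the swap exchanges the first two terms and fixes the third,
since the metric is symmetric. -/
lemma christoffelFirst_symm (x₀ : M) (a b c : E) :
    christoffelFirst x₀ a b c = christoffelFirst x₀ b a c := by
  rw [christoffelFirst_eq, christoffelFirst_eq, fderiv_chartForm_symm x₀ c b a]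
  ring

/-- The source of metric compatibility: the derivatives in the directions b and c cancel in the sum.
-/
lemma christoffelFirst_add_swap (x₀ : M) (a b c : E) :
    christoffelFirst x₀ a b c + christoffelFirst x₀ a c b =
      fderiv ℝ (chartForm x₀) (extChartAt 𝓘(ℝ, E) x₀ x₀) a b c := by
  rw [christoffelFirst_eq, christoffelFirst_eq, fderiv_chartForm_symm x₀ a c b]
  ring

lemma exists_christoffelFirst_linear (x₀ : M) (a b : E) :
    ∃ l : E →ₗ[ℝ] ℝ, ∀ c, l c = christoffelFirst x₀ a b c := by
  obtain ⟨l, hl⟩ := exists_koszul_linear (fderiv ℝ (chartForm x₀) (extChartAt 𝓘(ℝ, E) x₀ x₀)) a b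
  exact ⟨l, fun c => (hl c).trans (christoffelFirst_eq x₀ a b c).symm⟩

/-- Expanding c in the orthonormal basis undoes the raising of the index, because the first-kind
symbol is linear in its last slot. -/
lemma inner_christoffel (x₀ : M) (v w c : TangentSpace 𝓘(ℝ, E) x₀) :
    inner ℝ (christoffel x₀ v w) c =
      christoffelFirst x₀ (coords x₀ v) (coords x₀ w) (coords x₀ c) := by
  have : FiniteDimensional ℝ (TangentSpace 𝓘(ℝ, E) x₀) := inferInstanceAs (FiniteDimensional ℝ E)
  obtain ⟨l, hl⟩ := exists_christoffelFirst_linear x₀ (coords x₀ v) (coords x₀ w)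
  have hc := (stdOrthonormalBasis ℝ (TangentSpace 𝓘(ℝ, E) x₀)).sum_repr' c
  have hcoords : coords x₀ c = ∑ i, inner ℝ (stdOrthonormalBasis ℝ (TangentSpace 𝓘(ℝ, E) x₀) i) c •
      coords x₀ (stdOrthonormalBasis ℝ (TangentSpace 𝓘(ℝ, E) x₀) i) := by
    conv_lhs => rw [← hc]
    simp only [coords, map_sum, map_smul]
  rw [← hl, hcoords, map_sum, christoffel, sum_inner]
  refine Finset.sum_congr rfl fun i _ => ?_
  rw [map_smul, inner_smul_left, hl]
  simp [mul_comm]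

omit [FiniteDimensional ℝ E]
  [IsContMDiffRiemannianBundle 𝓘(ℝ, E) ∞ E (fun x : M => TangentSpace 𝓘(ℝ, E) x)] in
lemma inner_coordVec_self (x₀ : M) (a : E) (c : TangentSpace 𝓘(ℝ, E) x₀) :
    inner ℝ (coordVec x₀ a x₀) c =
      chartForm x₀ (extChartAt 𝓘(ℝ, E) x₀ x₀) a (coords x₀ c) := by
  rw [chartForm_apply, chartMetric, extChartAt_to_inv, coordVec_coords]

/-- Pairing with an arbitrary vector removes the orthonormal basis from view; compatibility with the
metric and torsion-freeness are both read off from this formula. -/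
lemma inner_covDeriv (g : N → M) (W : ∀ q, TangentSpace 𝓘(ℝ, E) (g q)) (q : N)
    (v : TangentSpace 𝓘(ℝ, F) q) (c : TangentSpace 𝓘(ℝ, E) (g q)) :
    inner ℝ (covDeriv F g W q v) c =
      chartForm (g q) (extChartAt 𝓘(ℝ, E) (g q) (g q))
          (mvfderiv 𝓘(ℝ, F) (fieldCoords (g q) g W) q v) (coords (g q) c)
        + christoffelFirst (g q) (coords (g q) (mfderiv 𝓘(ℝ, F) 𝓘(ℝ, E) g q v))
          (coords (g q) (W q)) (coords (g q) c) := by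
  rw [covDeriv, inner_add_left, inner_christoffel, inner_coordVec_self]

end Calculus

end ConstAngle

end

/-! ### Calculus of the Levi-Civita connection along maps -/

noncomputable section

namespace ConstAngle

section Calculus

variable {E : Type*} [NormedAddCommGroup E] [NormedSpace ℝ E]
  {M : Type*} [TopologicalSpace M] [ChartedSpace E M] [IsManifold 𝓘(ℝ, E) ∞ M]

/-- `W` is a vector field along `g` that is differentiable at `q`. -/
def IsDiffFieldAt {F : Type*} [NormedAddCommGroup F] [NormedSpace ℝ F]
    {N : Type*} [TopologicalSpace N] [ChartedSpace F N]
    (g : N → M) (W : ∀ q, TangentSpace 𝓘(ℝ, E) (g q)) (q : N) : Prop :=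
  MDifferentiableAt 𝓘(ℝ, F) (𝓘(ℝ, E).prod 𝓘(ℝ, E))
    (fun q => (⟨g q, W q⟩ : TangentBundle 𝓘(ℝ, E) M)) q

variable {F : Type*} [NormedAddCommGroup F] [NormedSpace ℝ F]

/-- The image of the constant vector field `w` under the differential of `h`. -/
def pushField (h : F → M) (w : F) (y : F) : TangentSpace 𝓘(ℝ, E) (h y) :=
  mfderiv 𝓘(ℝ, F) 𝓘(ℝ, E) h y ((NormedSpace.fromTangentSpace y).symm w)

omit [IsManifold 𝓘(ℝ, E) ∞ M] in
lemma pushField_add (h : F → M) (v w : F) (y : F) :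
    pushField (E := E) h (v + w) y = pushField h v y + pushField h w y := by
  simp [pushField]

omit [IsManifold 𝓘(ℝ, E) ∞ M] in
lemma pushField_zero (h : F → M) (y : F) : pushField (E := E) h 0 y = 0 := by
  simp [pushField]

omit [IsManifold 𝓘(ℝ, E) ∞ M] in
lemma pushField_smul (h : F → M) (r : ℝ) (w : F) (y : F) :
    pushField (E := E) h (r • w) y = r • pushField h w y := by
  simp [pushField]

omit [IsManifold 𝓘(ℝ, E) ∞ M] in
lemma velocity_comp {h : F → M} {y : ℝ → F} {y' : F} {t : ℝ} (hy : HasDerivAt y y' t)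
    (hh : MDifferentiableAt 𝓘(ℝ, F) 𝓘(ℝ, E) h (y t)) :
    velocity (E := E) (fun s => h (y s)) t = pushField h y' (y t) := by
  have h1 := mfderiv_comp_apply (I := 𝓘(ℝ, ℝ)) (I' := 𝓘(ℝ, F)) (I'' := 𝓘(ℝ, E)) t hh
    hy.differentiableAt.mdifferentiableAt (unitTangent t)
  have h2 : mfderiv 𝓘(ℝ, ℝ) 𝓘(ℝ, F) y t (unitTangent t) =
      (NormedSpace.fromTangentSpace (y t)).symm y' := by
    rw [mfderiv_eq_fderiv]
    have h3 : fderiv ℝ y t 1 = y' := by rw [fderiv_apply_one_eq_deriv, hy.deriv]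
    exact h3
  rw [h2] at h1
  exact h1

lemma fieldCoords_pushField_apply {h : F → M} {y : F}
    (hh : MDifferentiableAt 𝓘(ℝ, F) 𝓘(ℝ, E) h y) {x₀ : M} (hx : h y ∈ (chartAt E x₀).source)
    (w : F) :
    fieldCoords x₀ h (pushField h w) y = fderiv ℝ (fun y => extChartAt 𝓘(ℝ, E) x₀ (h y)) y w := by
  rw [fieldCoords_eq _ _ _ _ hx, pushField, coords_mfderiv hh hx, mvfderiv, mfderiv_eq_fderiv]
  rfl

/-- The formula is needed on a neighbourhood so that both sides can be differentiated at x. -/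
lemma eventually_fieldCoords_pushField {h : F → M} {x : F}
    (hh : ContMDiffAt 𝓘(ℝ, F) 𝓘(ℝ, E) ∞ h x) {x₀ : M} (hx : h x ∈ (chartAt E x₀).source) (w : F) :
    ∀ᶠ y in 𝓝 x, fieldCoords x₀ h (pushField h w) y =
      fderiv ℝ (fun y => extChartAt 𝓘(ℝ, E) x₀ (h y)) y w := by
  have : IsManifold 𝓘(ℝ, E) 1 M := IsManifold.of_le (n := ∞) (by simp)
  have h1 : ∀ᶠ y in 𝓝 x, ContMDiffAt 𝓘(ℝ, F) 𝓘(ℝ, E) 1 h y :=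
    (contMDiffAt_iff_contMDiffAt_nhds (by simp)).1 (hh.of_le (by simp))
  filter_upwards [h1, hh.continuousAt.eventually ((chartAt E x₀).open_source.mem_nhds hx)]
    with y hy hy'
  exact fieldCoords_pushField_apply (hy.mdifferentiableAt (by simp)) hy' w

lemma contDiffAt_extChartAt_comp {h : F → M} {x : F} (hh : ContMDiffAt 𝓘(ℝ, F) 𝓘(ℝ, E) ∞ h x)
    {x₀ : M} (hx : h x ∈ (chartAt E x₀).source) :
    ContDiffAt ℝ ∞ (fun y => extChartAt 𝓘(ℝ, E) x₀ (h y)) x :=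
  contMDiffAt_iff_contDiffAt.1 ((contMDiffAt_extChartAt' hx).comp x hh)

lemma contMDiffAt_pushField {h : F → M} {x : F} (hh : ContMDiffAt 𝓘(ℝ, F) 𝓘(ℝ, E) ∞ h x) (w : F) :
    ContMDiffAt 𝓘(ℝ, F) (𝓘(ℝ, E).prod 𝓘(ℝ, E)) ∞
      (fun y => (⟨h y, pushField h w y⟩ : TangentBundle 𝓘(ℝ, E) M)) x := by
  refine contMDiffAt_totalSpace.2 ⟨hh, ?_⟩
  have h1 := ((contDiffAt_extChartAt_comp hh (mem_chart_source E (h x))).fderiv_right (m := ∞)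
    (by simp)).clm_apply (contDiffAt_const (c := w))
  exact (contMDiffAt_iff_contDiffAt.2 h1).congr_of_eventuallyEq
    (eventually_fieldCoords_pushField hh (mem_chart_source E (h x)) w)

lemma isDiffFieldAt_pushField {h : F → M} {x : F} (hh : ContMDiffAt 𝓘(ℝ, F) 𝓘(ℝ, E) ∞ h x)
    (w : F) : IsDiffFieldAt (F := F) h (pushField (E := E) h w) x :=
  (contMDiffAt_pushField hh w).mdifferentiableAt (by simp)

lemma fieldCoords_sub_smul {N : Type*} (x₀ : M) (g : N → M)
    (V W : ∀ q, TangentSpace 𝓘(ℝ, E) (g q)) (k : ℝ) (q : N) (hq : g q ∈ (chartAt E x₀).source) :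
    fieldCoords x₀ g (fun q => V q - k • W q) q =
      fieldCoords x₀ g V q - k • fieldCoords x₀ g W q := by
  rw [fieldCoords_eq _ _ _ _ hq, fieldCoords_eq _ _ _ _ hq, fieldCoords_eq _ _ _ _ hq, map_sub,
    map_smul]

lemma IsDiffFieldAt.sub_smul {g : F → M} {V W : ∀ q, TangentSpace 𝓘(ℝ, E) (g q)} {q : F}
    (hV : IsDiffFieldAt (F := F) g V q) (hW : IsDiffFieldAt (F := F) g W q) (k : ℝ) :
    IsDiffFieldAt (F := F) g (fun q => V q - k • W q) q := by
  have hg := mdifferentiableAt_base hV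
  refine (mdifferentiableAt_totalSpace _ _).2 ⟨hg, ?_⟩
  have h1 := (mdifferentiableAt_fieldCoords hV).differentiableAt
  have h2 := (mdifferentiableAt_fieldCoords hW).differentiableAt
  refine (h1.sub (h2.const_smul k)).mdifferentiableAt.congr_of_eventuallyEq ?_
  filter_upwards [hg.continuousAt.eventually
    ((chartAt E (g q)).open_source.mem_nhds (mem_chart_source E (g q)))] with y hy
  exact fieldCoords_sub_smul (g q) g V W k y hy

variable [FiniteDimensional ℝ E] [RiemannianBundle (fun x : M => TangentSpace 𝓘(ℝ, E) x)]

/-- The chain rule for covariant derivatives. -/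
theorem covDeriv_comp {N : Type*} [TopologicalSpace N] [ChartedSpace F N]
    {F' : Type*} [NormedAddCommGroup F'] [NormedSpace ℝ F']
    {N' : Type*} [TopologicalSpace N'] [ChartedSpace F' N']
    {g : N → M} {W : ∀ q, TangentSpace 𝓘(ℝ, E) (g q)} {φ : N' → N} {q : N'}
    (hW : IsDiffFieldAt (F := F) g W (φ q)) (hφ : MDifferentiableAt 𝓘(ℝ, F') 𝓘(ℝ, F) φ q)
    (v : TangentSpace 𝓘(ℝ, F') q) :
    covDeriv F' (fun t => g (φ t)) (fun t => W (φ t)) q v =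
      covDeriv F g W (φ q) (mfderiv 𝓘(ℝ, F') 𝓘(ℝ, F) φ q v) := by
  have h1 : mvfderiv 𝓘(ℝ, F') (fieldCoords (g (φ q)) (fun t => g (φ t)) (fun t => W (φ t))) q v =
      mvfderiv 𝓘(ℝ, F) (fieldCoords (g (φ q)) g W) (φ q) (mfderiv 𝓘(ℝ, F') 𝓘(ℝ, F) φ q v) :=
    mfderiv_comp_apply q (mdifferentiableAt_fieldCoords hW) hφ v
  have h2 : mfderiv 𝓘(ℝ, F') 𝓘(ℝ, E) (fun t => g (φ t)) q v =
      mfderiv 𝓘(ℝ, F) 𝓘(ℝ, E) g (φ q) (mfderiv 𝓘(ℝ, F') 𝓘(ℝ, F) φ q v) :=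
    mfderiv_comp_apply q (mdifferentiableAt_base hW) hφ v
  simp only [covDeriv]
  rw [h1, h2]

lemma covDeriv_congr {N : Type*} [TopologicalSpace N] [ChartedSpace F N]
    {g : N → M} {W W' : ∀ q, TangentSpace 𝓘(ℝ, E) (g q)} {q : N} (h : ∀ᶠ y in 𝓝 q, W y = W' y)
    (v : TangentSpace 𝓘(ℝ, F) q) : covDeriv F g W q v = covDeriv F g W' q v := by
  have h1 : fieldCoords (g q) g W =ᶠ[𝓝 q] fieldCoords (g q) g W' := by
    filter_upwards [h] with y hy
    simp only [fieldCoords, hy]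
  simp only [covDeriv, mvfderiv, h1.mfderiv_eq, h.self_of_nhds]
  rfl

variable [IsContMDiffRiemannianBundle 𝓘(ℝ, E) ∞ E (fun x : M => TangentSpace 𝓘(ℝ, E) x)]

omit [FiniteDimensional ℝ E]
  [IsContMDiffRiemannianBundle 𝓘(ℝ, E) ∞ E (fun x : M => TangentSpace 𝓘(ℝ, E) x)] in
lemma chartForm_symm (x₀ : M) (y a b : E) : chartForm x₀ y a b = chartForm x₀ y b a := by
  rw [chartForm_apply, chartForm_apply, chartMetric_symm]

/-- The Levi-Civita connection is metric. -/
theorem hasFDerivAt_inner {g : F → M} {W₁ W₂ : ∀ q, TangentSpace 𝓘(ℝ, E) (g q)} {q : F}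
    (h₁ : IsDiffFieldAt (F := F) g W₁ q) (h₂ : IsDiffFieldAt (F := F) g W₂ q) :
    ∃ L : F →L[ℝ] ℝ, HasFDerivAt (fun y => (inner ℝ (W₁ y) (W₂ y) : ℝ)) L q ∧
      ∀ v : F, L v =
        inner ℝ (covDeriv F g W₁ q ((NormedSpace.fromTangentSpace q).symm v)) (W₂ q)
        + inner ℝ (W₁ q) (covDeriv F g W₂ q ((NormedSpace.fromTangentSpace q).symm v)) := by
  have hg := mdifferentiableAt_base h₁
  have hc₁ := (mdifferentiableAt_fieldCoords h₁).differentiableAt.hasFDerivAt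
  have hc₂ := (mdifferentiableAt_fieldCoords h₂).differentiableAt.hasFDerivAt
  have : IsManifold 𝓘(ℝ, E) 1 M := IsManifold.of_le (n := ∞) (by simp)
  have hĝ : HasFDerivAt (fun y => extChartAt 𝓘(ℝ, E) (g q) (g y)) _ q :=
    (((mdifferentiableAt_extChartAt (mem_chart_source E (g q))).comp q
      hg).differentiableAt).hasFDerivAt
  have hB : HasFDerivAt (fun y => chartForm (g q) (extChartAt 𝓘(ℝ, E) (g q) (g y))) _ q :=
    HasFDerivAt.comp (g := chartForm (E := E) (g q)) q (differentiableAt_chartForm (g q)).hasFDerivAt hĝ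
  have hall := (hB.clm_apply hc₁).clm_apply hc₂
  refine ⟨_, hall.congr_of_eventuallyEq ?_, fun v => ?_⟩
  · filter_upwards [hg.continuousAt.eventually
      ((chartAt E (g q)).open_source.mem_nhds (mem_chart_source E (g q)))] with y hy
    exact inner_eq_chartForm (g q) W₁ W₂ y hy
  · have hv : coords (g q) (mfderiv 𝓘(ℝ, F) 𝓘(ℝ, E) g q ((NormedSpace.fromTangentSpace q).symm v)) =
        fderiv ℝ (fun y => extChartAt 𝓘(ℝ, E) (g q) (g y)) q v := by
      have := coords_mfderiv (E := E) hg (mem_chart_source E (g q)) ((NormedSpace.fromTangentSpace q).symm v)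
      rw [mvfderiv, mfderiv_eq_fderiv] at this
      exact this
    have hm : ∀ W : ∀ q, TangentSpace 𝓘(ℝ, E) (g q),
        mvfderiv 𝓘(ℝ, F) (fieldCoords (g q) g W) q ((NormedSpace.fromTangentSpace q).symm v) =
          fderiv ℝ (fieldCoords (g q) g W) q v := by
      intro W
      rw [mvfderiv, mfderiv_eq_fderiv]
      rfl
    have hI₁ : inner ℝ (covDeriv F g W₁ q ((NormedSpace.fromTangentSpace q).symm v)) (W₂ q) = _ :=
      inner_covDeriv g W₁ q _ (W₂ q)
    have hI₂ : inner ℝ (W₁ q) (covDeriv F g W₂ q ((NormedSpace.fromTangentSpace q).symm v)) = _ :=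
      (real_inner_comm _ _).trans (inner_covDeriv g W₂ q _ (W₁ q))
    -- The two Christoffel terms add up to the derivative of the metric coefficients along the image
    -- of v; what remains is the product rule for the chart expression.
    rw [hI₁, hI₂, hv, hm, hm, ← fieldCoords_self g W₁ q, ← fieldCoords_self g W₂ q,
      add_add_add_comm, christoffelFirst_add_swap, chartForm_symm (g q) _
        (fderiv ℝ (fieldCoords (g q) g W₂) q v)]
    change chartForm (g q) (extChartAt 𝓘(ℝ, E) (g q) (g q)) (fieldCoords (g q) g W₁ q)
        (fderiv ℝ (fieldCoords (g q) g W₂) q v) +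
      (chartForm (g q) (extChartAt 𝓘(ℝ, E) (g q) (g q)) (fderiv ℝ (fieldCoords (g q) g W₁) q v)
        (fieldCoords (g q) g W₂ q) +
      fderiv ℝ (chartForm (g q)) (extChartAt 𝓘(ℝ, E) (g q) (g q))
        (fderiv ℝ (fun y => extChartAt 𝓘(ℝ, E) (g q) (g y)) q v) (fieldCoords (g q) g W₁ q)
        (fieldCoords (g q) g W₂ q)) = _
    ring

/-- The Levi-Civita connection is torsion free. -/
theorem covDeriv_pushField_symm {h : F → M} {x : F} (hh : ContMDiffAt 𝓘(ℝ, F) 𝓘(ℝ, E) ∞ h x)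
    (v w : F) :
    covDeriv F h (pushField (E := E) h w) x ((NormedSpace.fromTangentSpace x).symm v) =
      covDeriv F h (pushField (E := E) h v) x ((NormedSpace.fromTangentSpace x).symm w) := by
  have hsm := contDiffAt_extChartAt_comp (E := E) hh (mem_chart_source E (h x))
  -- The derivative parts agree because second derivatives of h in the chart commute; the
  -- Christoffel parts agree by `christoffelFirst_symm`.
  have hsymm : IsSymmSndFDerivAt ℝ (fun y => extChartAt 𝓘(ℝ, E) (h x) (h y)) x :=
    hsm.isSymmSndFDerivAt (by simpa using WithTop.coe_le_coe.2 (le_top : (2 : ℕ∞) ≤ ⊤))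
  have key : ∀ v w : F, mvfderiv 𝓘(ℝ, F) (fieldCoords (h x) h (pushField h w)) x
      ((NormedSpace.fromTangentSpace x).symm v) =
        fderiv ℝ (fderiv ℝ (fun y => extChartAt 𝓘(ℝ, E) (h x) (h y))) x v w := by
    intro v w
    have h1 := eventually_fieldCoords_pushField hh (mem_chart_source E (h x)) w
    have h2 := ((hsm.fderiv_right (m := ∞) (by simp)).differentiableAt (by simp)).hasFDerivAt
    have h3 := (h2.clm_apply (hasFDerivAt_const w x)).congr_of_eventuallyEq h1
    rw [mvfderiv, mfderiv_eq_fderiv, h3.fderiv, ContinuousLinearMap.comp_zero, zero_add]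
    rfl
  refine ext_inner_right ℝ fun c => ?_
  rw [inner_covDeriv, inner_covDeriv, key, key, hsymm v w, christoffelFirst_symm]
  rfl

end Calculus

end ConstAngle

end

/-! ### Local surfaces with a parallel axis -/

noncomputable section

namespace ConstAngle

section LocalSurface

variable {E : Type*} [NormedAddCommGroup E] [NormedSpace ℝ E]
  {M : Type*} [TopologicalSpace M] [ChartedSpace E M] [IsManifold 𝓘(ℝ, E) ∞ M]
  [FiniteDimensional ℝ E] [RiemannianBundle (fun x : M => TangentSpace 𝓘(ℝ, E) x)]
  {P : Type*} [NormedAddCommGroup P] [NormedSpace ℝ P]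

/-- The covariant derivative of a field along `h : P → M` in the direction of `a : P`. -/
abbrev dirCov (h : P → M) (W : ∀ q, TangentSpace 𝓘(ℝ, E) (h q)) (y : P) (a : P) :
    TangentSpace 𝓘(ℝ, E) (h y) :=
  covDeriv P h W y ((NormedSpace.fromTangentSpace y).symm a)

/-- A parametrized surface `h : U → M` with smooth unit normal `ν`. -/
structure LocalSurface (h : P → M) (U : Set P) (ν : ∀ q, TangentSpace 𝓘(ℝ, E) (h q)) : Prop where
  isOpen : IsOpen U
  smooth : ContMDiffOn 𝓘(ℝ, P) 𝓘(ℝ, E) ∞ h U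
  immersion : ∀ y ∈ U, ∀ a : P, pushField (E := E) h a y = 0 → a = 0
  smooth_normal : ContMDiffOn 𝓘(ℝ, P) (𝓘(ℝ, E).prod 𝓘(ℝ, E)) ∞
    (fun q => (⟨h q, ν q⟩ : TangentBundle 𝓘(ℝ, E) M)) U
  norm_normal : ∀ y ∈ U, ‖ν y‖ = 1
  orthogonal : ∀ y ∈ U, ∀ a : P, inner ℝ (pushField h a y) (ν y) = 0

/-- A parallel unit field `V` along the surface with `⟨V, ν⟩ = k`. -/
structure LocalAxis (h : P → M) (U : Set P) (ν V : ∀ q, TangentSpace 𝓘(ℝ, E) (h q)) (k : ℝ) :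
    Prop where
  smooth : ContMDiffOn 𝓘(ℝ, P) (𝓘(ℝ, E).prod 𝓘(ℝ, E)) ∞
    (fun q => (⟨h q, V q⟩ : TangentBundle 𝓘(ℝ, E) M)) U
  norm_eq_one : ∀ y ∈ U, ‖V y‖ = 1
  parallel : ∀ y ∈ U, ∀ a : P, dirCov h V y a = 0
  inner_eq : ∀ y ∈ U, inner ℝ (V y) (ν y) = k

/-- The differential of `h` at `y`. -/
def pushMap (h : P → M) (y : P) : P →L[ℝ] TangentSpace 𝓘(ℝ, E) (h y) :=
  (mfderiv 𝓘(ℝ, P) 𝓘(ℝ, E) h y).comp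
    (NormedSpace.fromTangentSpace y : TangentSpace 𝓘(ℝ, P) y ≃L[ℝ] P).symm.toContinuousLinearMap

/-- The first fundamental form. -/
def metricForm (h : P → M) (y : P) : P →L[ℝ] P →L[ℝ] ℝ :=
  (innerSL ℝ : TangentSpace 𝓘(ℝ, E) (h y) →L[ℝ] TangentSpace 𝓘(ℝ, E) (h y) →L[ℝ] ℝ).bilinearComp
    (pushMap h y)
    (pushMap h y)

/-- The linear form `a ↦ ⟨V, dh a⟩`. -/
def dualForm (h : P → M) (V : ∀ q, TangentSpace 𝓘(ℝ, E) (h q)) (y : P) : P →L[ℝ] ℝ :=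
  (innerSL ℝ (V y)).comp (pushMap h y)

omit [IsManifold 𝓘(ℝ, E) ∞ M] [FiniteDimensional ℝ E] in
lemma metricForm_apply (h : P → M) (y a b : P) :
    metricForm (E := E) h y a b = inner ℝ (pushField (E := E) h a y) (pushField h b y) := rfl

omit [IsManifold 𝓘(ℝ, E) ∞ M] [FiniteDimensional ℝ E] in
lemma dualForm_apply (h : P → M) (V : ∀ q, TangentSpace 𝓘(ℝ, E) (h q)) (y a : P) :
    dualForm h V y a = inner ℝ (V y) (pushField h a y) := rfl

namespace LocalSurface

variable {h : P → M} {U : Set P} {ν V : ∀ q, TangentSpace 𝓘(ℝ, E) (h q)} {k : ℝ} {y : P}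

omit [FiniteDimensional ℝ E] in
lemma contMDiffAt (H : LocalSurface h U ν) (hy : y ∈ U) : ContMDiffAt 𝓘(ℝ, P) 𝓘(ℝ, E) ∞ h y :=
  H.smooth.contMDiffAt (H.isOpen.mem_nhds hy)

omit [FiniteDimensional ℝ E] in
lemma isDiffFieldAt_normal (H : LocalSurface h U ν) (hy : y ∈ U) : IsDiffFieldAt (F := P) h ν y :=
  (H.smooth_normal.contMDiffAt (H.isOpen.mem_nhds hy)).mdifferentiableAt (by simp)

lemma isDiffFieldAt_axis (H : LocalSurface h U ν) (A : LocalAxis h U ν V k) (hy : y ∈ U) :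
    IsDiffFieldAt (F := P) h V y :=
  (A.smooth.contMDiffAt (H.isOpen.mem_nhds hy)).mdifferentiableAt (by simp)

omit [FiniteDimensional ℝ E] in
lemma isDiffFieldAt_push (H : LocalSurface h U ν) (hy : y ∈ U) (a : P) :
    IsDiffFieldAt (F := P) h (pushField (E := E) h a) y :=
  isDiffFieldAt_pushField (H.contMDiffAt hy) a

/-- A dimension count: the image of the injective differential lies in the orthogonal complement of
ν, and both have dimension 2. -/
lemma exists_pushField_eq (H : LocalSurface h U ν) (hE : Module.finrank ℝ E = 3)
    (hP : Module.finrank ℝ P = 2) (hy : y ∈ U) (u : TangentSpace 𝓘(ℝ, E) (h y))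
    (hu : inner ℝ u (ν y) = 0) : ∃ a : P, pushField h a y = u := by
  have : FiniteDimensional ℝ (TangentSpace 𝓘(ℝ, E) (h y)) := inferInstanceAs (FiniteDimensional ℝ E)
  have : FiniteDimensional ℝ P := Module.finite_of_finrank_eq_succ hP
  let D : P →ₗ[ℝ] TangentSpace 𝓘(ℝ, E) (h y) :=
    { toFun := fun a => pushField h a y
      map_add' := fun a b => pushField_add h a b y
      map_smul' := fun r a => pushField_smul h r a y }
  have hinj : Function.Injective D :=
    (injective_iff_map_eq_zero D).2 fun a ha => H.immersion y hy a ha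
  have hν : ν y ≠ 0 := fun h0 => by simpa [h0] using H.norm_normal y hy
  have hle : D.range ≤ (Submodule.span ℝ {ν y})ᗮ := by
    rintro _ ⟨a, rfl⟩
    rw [Submodule.mem_orthogonal_singleton_iff_inner_left]
    exact H.orthogonal y hy a
  have hT : Module.finrank ℝ (TangentSpace 𝓘(ℝ, E) (h y)) = 2 + 1 := hE
  have h1 : Module.finrank ℝ (Submodule.span ℝ {ν y})ᗮ = 2 :=
    have : Fact (Module.finrank ℝ (TangentSpace 𝓘(ℝ, E) (h y)) = 2 + 1) := ⟨hT⟩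
    Submodule.finrank_orthogonal_span_singleton hν
  have heq := Submodule.eq_of_le_of_finrank_eq hle
    (by rw [h1, LinearMap.finrank_range_of_inj hinj, hP])
  have hmem : u ∈ (Submodule.span ℝ {ν y})ᗮ :=
    (Submodule.mem_orthogonal_singleton_iff_inner_left).2 hu
  rw [← heq] at hmem
  exact hmem

lemma eq_zero_of_inner (H : LocalSurface h U ν) (hE : Module.finrank ℝ E = 3)
    (hP : Module.finrank ℝ P = 2) (hy : y ∈ U) (u : TangentSpace 𝓘(ℝ, E) (h y))
    (hu : inner ℝ u (ν y) = 0) (hu' : ∀ a : P, inner ℝ u (pushField h a y) = 0) : u = 0 := by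
  obtain ⟨a, rfl⟩ := H.exists_pushField_eq hE hP hy u hu
  exact inner_self_eq_zero.1 (hu' a)

lemma inner_tangential_normal (H : LocalSurface h U ν) (A : LocalAxis h U ν V k) (hy : y ∈ U) :
    inner ℝ (V y - k • ν y) (ν y) = 0 := by
  rw [inner_sub_left, inner_smul_left, A.inner_eq y hy, real_inner_self_eq_norm_sq,
    H.norm_normal y hy]
  simp

/-- The tangential part of the axis has constant length, so the case split on k² = 1 is valid on the
whole surface at once. -/
lemma inner_tangential_self (H : LocalSurface h U ν) (A : LocalAxis h U ν V k) (hy : y ∈ U) :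
    inner ℝ (V y - k • ν y) (V y - k • ν y) = 1 - k ^ 2 := by
  rw [inner_sub_right, inner_smul_right, H.inner_tangential_normal A hy, inner_sub_left,
    inner_smul_left, real_inner_comm (V y) (ν y), A.inner_eq y hy, real_inner_self_eq_norm_sq,
    A.norm_eq_one y hy, conj_trivial]
  ring

variable [IsContMDiffRiemannianBundle 𝓘(ℝ, E) ∞ E (fun x : M => TangentSpace 𝓘(ℝ, E) x)]

/-- The product rule for two fields with constant inner product. -/
lemma inner_dirCov_add (H : LocalSurface h U ν) (hy : y ∈ U)
    {W₁ W₂ : ∀ q, TangentSpace 𝓘(ℝ, E) (h q)} (h₁ : IsDiffFieldAt (F := P) h W₁ y)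
    (h₂ : IsDiffFieldAt (F := P) h W₂ y) {r : ℝ} (hr : ∀ y ∈ U, inner ℝ (W₁ y) (W₂ y) = r)
    (a : P) : inner ℝ (dirCov h W₁ y a) (W₂ y) + inner ℝ (W₁ y) (dirCov h W₂ y a) = 0 := by
  obtain ⟨L, hL, hLv⟩ := hasFDerivAt_inner h₁ h₂
  have hL0 : HasFDerivAt (fun y => (inner ℝ (W₁ y) (W₂ y) : ℝ)) (0 : P →L[ℝ] ℝ) y := by
    refine (hasFDerivAt_const r y).congr_of_eventuallyEq ?_
    filter_upwards [H.isOpen.mem_nhds hy] with z hz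
    exact hr z hz
  rw [← hLv, hL.unique hL0]
  rfl

lemma inner_dirCov_normal_normal (H : LocalSurface h U ν) (hy : y ∈ U) (a : P) :
    inner ℝ (dirCov h ν y a) (ν y) = 0 := by
  have h1 := H.inner_dirCov_add hy (H.isDiffFieldAt_normal hy) (H.isDiffFieldAt_normal hy) (r := 1)
    (fun y hy => by rw [real_inner_self_eq_norm_sq, H.norm_normal y hy, one_pow]) a
  rw [real_inner_comm (dirCov h ν y a)] at h1
  linarith

/-- Differentiating the constant ⟨V, ν⟩ leaves only this term, since V is parallel. This is where
the constant angle enters. -/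
lemma inner_dirCov_normal_axis (H : LocalSurface h U ν) (A : LocalAxis h U ν V k) (hy : y ∈ U)
    (a : P) : inner ℝ (dirCov h ν y a) (V y) = 0 := by
  have h1 := H.inner_dirCov_add hy (H.isDiffFieldAt_axis A hy) (H.isDiffFieldAt_normal hy)
    A.inner_eq a
  rw [A.parallel y hy a, inner_zero_left, zero_add, real_inner_comm] at h1
  exact h1

/-- The shape operator is symmetric. -/
lemma inner_dirCov_normal_symm (H : LocalSurface h U ν) (hy : y ∈ U) (a b : P) :
    inner ℝ (dirCov h ν y a) (pushField h b y) = inner ℝ (dirCov h ν y b) (pushField h a y) := by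
  have key : ∀ a b : P, inner ℝ (dirCov h ν y a) (pushField h b y)
      + inner ℝ (ν y) (dirCov h (pushField (E := E) h b) y a) = 0 := fun a b =>
    H.inner_dirCov_add hy (H.isDiffFieldAt_normal hy) (H.isDiffFieldAt_push hy b)
      (fun y hy => (real_inner_comm _ _).trans (H.orthogonal y hy b)) a
  have h1 := key a b
  have h2 := key b a
  rw [show dirCov h (pushField (E := E) h b) y a = dirCov h (pushField (E := E) h a) y b from
    covDeriv_pushField_symm (H.contMDiffAt hy) a b] at h1
  linarith

/-- The covariant derivative of `V - k ν`, tested against a field `Z`. -/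
lemma inner_dirCov_sub_smul {W Z : ∀ q, TangentSpace 𝓘(ℝ, E) (h q)}
    (hV : IsDiffFieldAt (F := P) h V y) (hW : IsDiffFieldAt (F := P) h W y)
    (hZ : IsDiffFieldAt (F := P) h Z y) (a : P) :
    inner ℝ (dirCov h (fun y => V y - k • W y) y a) (Z y) =
      inner ℝ (dirCov h V y a) (Z y) - k * inner ℝ (dirCov h W y a) (Z y) := by
  -- Linearity of the covariant derivative is extracted from the metric property: in the three
  -- differentiated inner products with Z the terms containing ∇Z cancel.
  obtain ⟨L, hL, hLv⟩ := hasFDerivAt_inner (hV.sub_smul hW k) hZ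
  obtain ⟨L₁, hL₁, hLv₁⟩ := hasFDerivAt_inner hV hZ
  obtain ⟨L₂, hL₂, hLv₂⟩ := hasFDerivAt_inner hW hZ
  have h1 : HasFDerivAt (fun y => (inner ℝ (V y - k • W y) (Z y) : ℝ)) (L₁ - k • L₂) y := by
    refine (hL₁.sub (hL₂.const_mul k)).congr_of_eventuallyEq (.of_forall fun z => ?_)
    simp only [inner_sub_left, inner_smul_left]
    rfl
  have h2 : L a = L₁ a - k * L₂ a := by
    rw [hL.unique h1]
    rfl
  rw [hLv, hLv₁, hLv₂, inner_sub_left, inner_smul_left] at h2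
  simp only [conj_trivial] at h2
  linarith

/-- Here V = k ν on the surface with k = ±1, so the normal is parallel along with V and the shape
operator vanishes. -/
lemma inner_dirCov_normal_eq_zero (H : LocalSurface h U ν) (A : LocalAxis h U ν V k)
    (hk : k ^ 2 = 1) (hy : y ∈ U) (a b : P) :
    inner ℝ (dirCov h ν y a) (pushField h b y) = 0 := by
  have hT : ∀ y ∈ U, V y - k • ν y = 0 := fun y hy => by
    rw [← inner_self_eq_zero (𝕜 := ℝ), H.inner_tangential_self A hy, hk, sub_self]
  have hd := H.isDiffFieldAt_axis A hy
  have h1 := H.inner_dirCov_add hy (hd.sub_smul (H.isDiffFieldAt_normal hy) k)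
    (H.isDiffFieldAt_push hy b) (r := 0) (fun y hy => by rw [hT y hy, inner_zero_left]) a
  rw [hT y hy, inner_zero_left, add_zero, inner_dirCov_sub_smul hd (H.isDiffFieldAt_normal hy)
    (H.isDiffFieldAt_push hy b), A.parallel y hy, inner_zero_left, zero_sub, neg_eq_zero] at h1
  refine (mul_eq_zero.1 h1).resolve_left fun h0 => ?_
  rw [h0] at hk
  norm_num at hk

/-- The second fundamental form is degenerate. -/
theorem exists_dirCov_normal_orthogonal (H : LocalSurface h U ν) (A : LocalAxis h U ν V k)
    (hE : Module.finrank ℝ E = 3) (hP : Module.finrank ℝ P = 2) (hy : y ∈ U) :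
    ∃ a : P, a ≠ 0 ∧ ∀ b : P, inner ℝ (dirCov h ν y b) (pushField h a y) = 0 := by
  by_cases hk : k ^ 2 = 1
  · have : Nontrivial P := Module.nontrivial_of_finrank_pos (R := ℝ) (by omega)
    obtain ⟨a, ha⟩ := exists_ne (0 : P)
    exact ⟨a, ha, fun b => H.inner_dirCov_normal_eq_zero A hk hy b a⟩
  -- The null direction is the tangential part of the axis, nonzero because its squared length is 1
  -- - k².
  · obtain ⟨a, ha⟩ := H.exists_pushField_eq hE hP hy _ (H.inner_tangential_normal A hy)
    refine ⟨a, fun h0 => hk ?_, fun b => ?_⟩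
    · have h1 := H.inner_tangential_self A hy
      rw [← ha, h0, pushField_zero, inner_zero_left] at h1
      linarith
    · rw [ha, inner_sub_right, inner_smul_right, H.inner_dirCov_normal_axis A hy,
        H.inner_dirCov_normal_normal hy, mul_zero, sub_zero]

omit [FiniteDimensional ℝ E] in
lemma contDiffOn_metricForm [FiniteDimensional ℝ P] (H : LocalSurface h U ν) :
    ContDiffOn ℝ ∞ (metricForm (E := E) h) U := by
  refine contDiffOn_clm_apply.2 fun a => contDiffOn_clm_apply.2 fun b => fun y hy => ?_
  have h1 := ContMDiffAt.inner_bundle (IB := 𝓘(ℝ, E)) (E := fun x : M => TangentSpace 𝓘(ℝ, E) x)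
    (contMDiffAt_pushField (H.contMDiffAt hy) a) (contMDiffAt_pushField (H.contMDiffAt hy) b)
  exact (contMDiffAt_iff_contDiffAt.1 h1).contDiffWithinAt

lemma contDiffOn_dualForm [FiniteDimensional ℝ P] (H : LocalSurface h U ν)
    (A : LocalAxis h U ν V k) : ContDiffOn ℝ ∞ (dualForm h V) U := by
  refine contDiffOn_clm_apply.2 fun a => fun y hy => ?_
  have h1 := ContMDiffAt.inner_bundle (IB := 𝓘(ℝ, E)) (E := fun x : M => TangentSpace 𝓘(ℝ, E) x)
    (A.smooth.contMDiffAt (H.isOpen.mem_nhds hy)) (contMDiffAt_pushField (H.contMDiffAt hy) a)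
  exact (contMDiffAt_iff_contDiffAt.1 h1).contDiffWithinAt

omit [FiniteDimensional ℝ E]
  [IsContMDiffRiemannianBundle 𝓘(ℝ, E) ∞ E (fun x : M => TangentSpace 𝓘(ℝ, E) x)] in
-- An immersion induces a positive definite form, which is therefore injective into the dual, and
-- the dimensions agree.
lemma exists_metricForm_equiv [FiniteDimensional ℝ P] (H : LocalSurface h U ν) (hy : y ∈ U) :
    ∃ e : P ≃L[ℝ] (P →L[ℝ] ℝ), (e : P →L[ℝ] P →L[ℝ] ℝ) = metricForm (E := E) h y := by
  have hinj : Function.Injective (metricForm (E := E) h y) := by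
    refine (injective_iff_map_eq_zero _).2 fun a ha => H.immersion y hy a ?_
    refine inner_self_eq_zero (𝕜 := ℝ).1 ?_
    rw [← metricForm_apply, ha]
    rfl
  have hdim : Module.finrank ℝ P = Module.finrank ℝ (P →L[ℝ] ℝ) :=
    Subspace.dual_finrank_eq.symm.trans
      (LinearMap.toContinuousLinearMap : (P →ₗ[ℝ] ℝ) ≃ₗ[ℝ] (P →L[ℝ] ℝ)).finrank_eq
  exact ⟨(LinearEquiv.ofInjectiveOfFinrankEq (metricForm (E := E) h y).toLinearMap hinj
    hdim).toContinuousLinearEquiv, by ext1; rfl⟩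

omit [FiniteDimensional ℝ E]
  [IsContMDiffRiemannianBundle 𝓘(ℝ, E) ∞ E (fun x : M => TangentSpace 𝓘(ℝ, E) x)] in
lemma metricForm_inverse_apply [FiniteDimensional ℝ P] (H : LocalSurface h U ν) (hy : y ∈ U)
    (m : P →L[ℝ] ℝ) : metricForm (E := E) h y ((metricForm (E := E) h y).inverse m) = m := by
  obtain ⟨e, he⟩ := H.exists_metricForm_equiv hy
  rw [← he, ContinuousLinearMap.inverse_equiv]
  exact e.apply_symm_apply m

omit [FiniteDimensional ℝ E]
  [IsContMDiffRiemannianBundle 𝓘(ℝ, E) ∞ E (fun x : M => TangentSpace 𝓘(ℝ, E) x)] in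
lemma inverse_metricForm_apply [FiniteDimensional ℝ P] (H : LocalSurface h U ν) (hy : y ∈ U)
    (a : P) : (metricForm (E := E) h y).inverse (metricForm (E := E) h y a) = a := by
  obtain ⟨e, he⟩ := H.exists_metricForm_equiv hy
  rw [← he, ContinuousLinearMap.inverse_equiv]
  exact e.symm_apply_apply a

omit [FiniteDimensional ℝ E] in
lemma contDiffOn_metricForm_inverse [FiniteDimensional ℝ P] (H : LocalSurface h U ν) :
    ContDiffOn ℝ ∞ (fun y => (metricForm (E := E) h y).inverse) U := by
  intro y hy
  obtain ⟨e, he⟩ := H.exists_metricForm_equiv hy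
  have h1 : ContDiffAt ℝ ∞ ContinuousLinearMap.inverse (metricForm (E := E) h y) :=
    he ▸ contDiffAt_map_inverse e
  exact h1.comp_contDiffWithinAt y (H.contDiffOn_metricForm y hy)

end LocalSurface

end LocalSurface

end ConstAngle

end

/-! ### Rulings of a local surface by geodesics -/

noncomputable section

namespace ConstAngle

/-- The derivative of a smooth map in a fixed direction, as a function on a product. -/
lemma contDiffOn_fderiv_fst_apply {P Q G : Type*} [NormedAddCommGroup P] [NormedSpace ℝ P]
    [NormedAddCommGroup Q] [NormedSpace ℝ Q] [NormedAddCommGroup G] [NormedSpace ℝ G]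
    {g : P → G} {U : Set P} (hU : IsOpen U) (hg : ContDiffOn ℝ ∞ g U) (e : P) :
    ContDiffOn ℝ ∞ (fun z : P × Q => fderiv ℝ g z.1 e) (U ×ˢ univ) := by
  have h2 : ContDiffOn ℝ ∞ (fun z : P × Q => fderiv ℝ g z.1) (U ×ˢ univ) :=
    (hg.fderiv_of_isOpen hU (m := ∞) (by simp)).comp contDiffOn_fst fun z hz => hz.1
  exact h2.clm_apply contDiffOn_const

namespace LocalSurface

variable {E : Type*} [NormedAddCommGroup E] [NormedSpace ℝ E]
  {M : Type*} [TopologicalSpace M] [ChartedSpace E M] [IsManifold 𝓘(ℝ, E) ∞ M]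
  [FiniteDimensional ℝ E] [RiemannianBundle (fun x : M => TangentSpace 𝓘(ℝ, E) x)]
  [IsContMDiffRiemannianBundle 𝓘(ℝ, E) ∞ E (fun x : M => TangentSpace 𝓘(ℝ, E) x)]
  {P : Type*} [NormedAddCommGroup P] [NormedSpace ℝ P]
  {h : P → M} {U : Set P} {ν V : ∀ q, TangentSpace 𝓘(ℝ, E) (h q)} {k : ℝ}

omit [IsContMDiffRiemannianBundle 𝓘(ℝ, E) ∞ E (fun x : M => TangentSpace 𝓘(ℝ, E) x)] in
lemma covDeriv_curve {W : ∀ q, TangentSpace 𝓘(ℝ, E) (h q)} {y : ℝ → P} {y' : P} {t : ℝ}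
    (hW : IsDiffFieldAt (F := P) h W (y t)) (hy : HasDerivAt y y' t) :
    covDeriv ℝ (fun s => h (y s)) (fun s => W (y s)) t (unitTangent t) = dirCov h W (y t) y' := by
  rw [covDeriv_comp hW hy.differentiableAt.mdifferentiableAt]
  have h1 : mfderiv 𝓘(ℝ, ℝ) 𝓘(ℝ, P) y t (unitTangent t) =
      (NormedSpace.fromTangentSpace (y t)).symm y' := by
    rw [mfderiv_eq_fderiv]
    have h3 : fderiv ℝ y t 1 = y' := by rw [fderiv_apply_one_eq_deriv, hy.deriv]
    exact h3
  rw [h1]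

omit [FiniteDimensional ℝ E]
  [RiemannianBundle (fun x : M => TangentSpace 𝓘(ℝ, E) x)]
  [IsContMDiffRiemannianBundle 𝓘(ℝ, E) ∞ E (fun x : M => TangentSpace 𝓘(ℝ, E) x)] in
lemma isDiffFieldAt_comp {W : ∀ q, TangentSpace 𝓘(ℝ, E) (h q)} {y : ℝ → P} {t : ℝ}
    (hW : IsDiffFieldAt (F := P) h W (y t)) (hy : DifferentiableAt ℝ y t) :
    IsDiffFieldAt (F := ℝ) (fun s => h (y s)) (fun s => W (y s)) t :=
  MDifferentiableAt.comp t hW hy.mdifferentiableAt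

/-- A curve of a totally geodesic surface satisfying the Euler-Lagrange equations of the energy is
a geodesic of the ambient manifold. -/
theorem velocity_parallel_of_eulerLagrange (H : LocalSurface h U ν)
    (hE : Module.finrank ℝ E = 3) (hP : Module.finrank ℝ P = 2) {y p : ℝ → P} {t : ℝ}
    (hU : ∀ᶠ s in 𝓝 t, y s ∈ U) (hyt : ContDiffAt ℝ ∞ y t)
    (hy : ∀ᶠ s in 𝓝 t, HasDerivAt y (p s) s)
    (hflat : ∀ a b : P, inner ℝ (dirCov h ν (y t) a) (pushField h b (y t)) = 0)
    (hEL : ∀ e : P, HasDerivAt (fun s => metricForm (E := E) h (y s) (p s) e)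
      ((1 / 2 : ℝ) * fderiv ℝ (metricForm (E := E) h) (y t) e (p t) (p t)) t) :
    covDeriv ℝ (fun s => h (y s)) (velocity (E := E) (fun s => h (y s))) t (unitTangent t) = 0 := by
  have : FiniteDimensional ℝ P := Module.finite_of_finrank_eq_succ hP
  have hUt : y t ∈ U := hU.self_of_nhds
  have hc : ContMDiffAt 𝓘(ℝ, ℝ) 𝓘(ℝ, E) ∞ (fun s => h (y s)) t :=
    (H.contMDiffAt hUt).comp t hyt.contMDiffAt
  have hvel : ∀ᶠ s in 𝓝 t, velocity (E := E) (fun s => h (y s)) s = pushField h (p s) (y s) := by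
    filter_upwards [hU, hy] with s hs hs'
    exact velocity_comp hs' ((H.contMDiffAt hs).mdifferentiableAt (by simp))
  have hZ : IsDiffFieldAt (F := ℝ) (fun s => h (y s)) (velocity (E := E) (fun s => h (y s))) t :=
    isDiffFieldAt_pushField hc 1
  have hyd : DifferentiableAt ℝ y t := hy.self_of_nhds.differentiableAt
  have hprod : ∀ (W : ∀ q, TangentSpace 𝓘(ℝ, E) (h q)), IsDiffFieldAt (F := P) h W (y t) →
      ∀ r : ℝ, HasDerivAt (fun s => (inner ℝ (pushField (E := E) h (p s) (y s)) (W (y s)) : ℝ)) r t →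
      r = inner ℝ (covDeriv ℝ (fun s => h (y s)) (velocity (E := E) (fun s => h (y s))) t
          (unitTangent t)) (W (y t))
        + inner ℝ (pushField h (p t) (y t)) (dirCov h W (y t) (p t)) := by
    intro W hW r hr
    obtain ⟨L, hL, hLv⟩ := hasFDerivAt_inner hZ (isDiffFieldAt_comp hW hyd)
    have h1 := hL.hasDerivAt
    have h2 : HasDerivAt (fun s => (inner ℝ (velocity (E := E) (fun s => h (y s)) s) (W (y s)) : ℝ))
        r t := by
      refine hr.congr_of_eventuallyEq ?_
      filter_upwards [hvel] with s hs
      rw [hs]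
    rw [h2.unique h1, hLv 1]
    have h3 := covDeriv_curve hW hy.self_of_nhds
    rw [← h3, ← hvel.self_of_nhds]
    rfl
  refine H.eq_zero_of_inner hE hP hUt _ ?_ fun e => ?_
  -- Normal component: the velocity stays orthogonal to ν, and ∇ν has no tangential part by `hflat`.
  · have h0 : HasDerivAt (fun s => (inner ℝ (pushField (E := E) h (p s) (y s)) (ν (y s)) : ℝ)) 0 t := by
      refine (hasDerivAt_const t (0 : ℝ)).congr_of_eventuallyEq ?_
      filter_upwards [hU] with s hs
      exact H.orthogonal _ hs _
    have h1 := hprod ν (H.isDiffFieldAt_normal hUt) 0 h0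
    rw [real_inner_comm (dirCov h ν (y t) (p t)), hflat, add_zero] at h1
    exact h1.symm
  -- Tangential component: by torsion-freeness ⟨p, ∇_p e⟩ = ⟨p, ∇_e p⟩, which is half the
  -- e-derivative of g(p, p). This is exactly the right-hand side of the Euler-Lagrange equation.
  · have h1 := hprod (pushField h e) (H.isDiffFieldAt_push hUt e) _ (hEL e)
    have hsymm : dirCov h (pushField (E := E) h e) (y t) (p t) =
        dirCov h (pushField (E := E) h (p t)) (y t) e :=
      covDeriv_pushField_symm (H.contMDiffAt hUt) _ _
    obtain ⟨L, hL, hLv⟩ := hasFDerivAt_inner (H.isDiffFieldAt_push hUt (p t))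
      (H.isDiffFieldAt_push hUt (p t))
    have hg := ((H.contDiffOn_metricForm.contDiffAt (H.isOpen.mem_nhds hUt)).differentiableAt
      (by simp)).hasFDerivAt
    have hg' := (hg.clm_apply (hasFDerivAt_const (p t) (y t))).clm_apply
      (hasFDerivAt_const (p t) (y t))
    have h2 : L e = fderiv ℝ (metricForm (E := E) h) (y t) e (p t) (p t) := by
      rw [hL.unique hg', ContinuousLinearMap.comp_zero, ContinuousLinearMap.comp_zero, zero_add,
        zero_add]
      rfl
    rw [hLv, real_inner_comm (pushField h (p t) (y t))] at h2
    rw [hsymm, ← h2] at h1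
    linarith

/-- The Hamiltonian vector field of the energy of the first fundamental form. -/
def geodesicField (h : P → M) (z : P × (P →L[ℝ] ℝ)) : P × (P →L[ℝ] ℝ) :=
  ((metricForm (E := E) h z.1).inverse z.2,
    -- The momentum equation ṗ = -∂H for H = ½ g⁻¹(p, p), rewritten as ½ (∂g)(ẏ, ẏ) with ẏ = g⁻¹ p;
    -- hence the plus sign.
    (1 / 2 : ℝ) • ((fderiv ℝ (metricForm (E := E) h) z.1).flip
      ((metricForm (E := E) h z.1).inverse z.2)).flip ((metricForm (E := E) h z.1).inverse z.2))

omit [FiniteDimensional ℝ E] in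
lemma contDiffOn_geodesicField [FiniteDimensional ℝ P] (H : LocalSurface h U ν) :
    ContDiffOn ℝ ∞ (geodesicField (E := E) h) (U ×ˢ univ) := by
  have hfst : MapsTo (Prod.fst : P × (P →L[ℝ] ℝ) → P) (U ×ˢ univ) U := fun z hz => hz.1
  have h1 : ContDiffOn ℝ ∞ (fun z : P × (P →L[ℝ] ℝ) => (metricForm (E := E) h z.1).inverse z.2)
      (U ×ˢ univ) :=
    (H.contDiffOn_metricForm_inverse.comp contDiffOn_fst hfst).clm_apply contDiffOn_snd
  refine h1.prodMk (contDiffOn_clm_apply.2 fun e => ?_)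
  have h2 := contDiffOn_fderiv_fst_apply (Q := P →L[ℝ] ℝ) H.isOpen H.contDiffOn_metricForm e
  exact contDiffOn_const.mul ((h2.clm_apply h1).clm_apply h1)

/-- The conclusion of the local theory: a family of geodesics that are tangent to `V - k ν`. -/
def HasRuledCoordinates (h : P → M) (U : Set P) (T : ∀ q, TangentSpace 𝓘(ℝ, E) (h q)) (x₀ : P) :
    Prop :=
  ∃ δ > 0, ∃ Y : ℝ × ℝ → P, Y (0, 0) = x₀ ∧
    ContDiffOn ℝ ∞ Y (Ioo (-δ) δ ×ˢ Ioo (-δ) δ) ∧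
    MapsTo Y (Ioo (-δ) δ ×ˢ Ioo (-δ) δ) U ∧
    InjOn Y (Ioo (-δ) δ ×ˢ Ioo (-δ) δ) ∧
    (∀ z ∈ Ioo (-δ) δ ×ˢ Ioo (-δ) δ, Function.Injective (fderiv ℝ Y z)) ∧
    ∀ u ∈ Ioo (-δ) δ, ∀ v ∈ Ioo (-δ) δ,
      covDeriv ℝ (fun s => h (Y (u, s))) (velocity (E := E) (fun s => h (Y (u, s)))) v
        (unitTangent v) = 0 ∧
      T (Y (u, v)) ∈ Submodule.span ℝ {velocity (E := E) (fun s => h (Y (u, s))) v}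

omit [IsManifold 𝓘(ℝ, E) ∞ M] [FiniteDimensional ℝ E]
  [RiemannianBundle (fun x : M => TangentSpace 𝓘(ℝ, E) x)]
  [IsContMDiffRiemannianBundle 𝓘(ℝ, E) ∞ E (fun x : M => TangentSpace 𝓘(ℝ, E) x)] in
lemma exists_pair (hP : Module.finrank ℝ P = 2) {a : P} (ha : a ≠ 0) :
    ∃ d : P, LinearIndependent ℝ ![d, a] := by
  obtain ⟨d, hd⟩ := exists_linearIndependent_pair_of_one_lt_finrank (R := ℝ) (M := P) (by omega) ha
  exact ⟨d, LinearIndependent.pair_symm_iff.1 hd⟩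

/-- A totally geodesic surface is foliated by geodesics. -/
theorem hasRuledCoordinates_of_flat (H : LocalSurface h U ν)
    (hE : Module.finrank ℝ E = 3) (hP : Module.finrank ℝ P = 2)
    (hflat : ∀ y ∈ U, ∀ a b : P, inner ℝ (dirCov h ν y a) (pushField h b y) = 0)
    {T : ∀ q, TangentSpace 𝓘(ℝ, E) (h q)} (hT : ∀ y ∈ U, T y = 0) {x₀ : P} (hx₀ : x₀ ∈ U) :
    HasRuledCoordinates h U T x₀ := by
  have : FiniteDimensional ℝ P := Module.finite_of_finrank_eq_succ hP
  have : Nontrivial P := Module.nontrivial_of_finrank_pos (R := ℝ) (by omega)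
  obtain ⟨e₁, he₁⟩ := exists_ne (0 : P)
  obtain ⟨d, hd⟩ := exists_pair hP he₁
  -- Flow in phase space from positions x₀ + u d with the fixed momentum g(e₁, ·) taken at x₀. The
  -- initial velocity at x₀ is e₁, independent of d, so the projection to positions is a local
  -- parametrization.
  obtain ⟨δ, hδ, ψ, hψ0, hψ, hψU, hψd, hinj, himm⟩ :=
    SmoothFlow.exists_flow_parametrization hP (H.isOpen.prod isOpen_univ)
      H.contDiffOn_geodesicField (e₀ := (x₀, metricForm (E := E) h x₀ e₁)) ⟨hx₀, mem_univ _⟩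
      (ContinuousLinearMap.fst ℝ P (P →L[ℝ] ℝ)) (d, 0)
      (by
        simpa only [ContinuousLinearMap.coe_fst', geodesicField, H.inverse_metricForm_apply hx₀]
          using hd)
  have hopen : IsOpen (Ioo (-δ) δ ×ˢ Ioo (-δ) δ) := isOpen_Ioo.prod isOpen_Ioo
  refine ⟨δ, hδ, fun z => (ψ z).1, congrArg Prod.fst hψ0, contDiff_fst.comp_contDiffOn hψ,
    fun z hz => (hψU hz).1, hinj, himm, fun u hu v hv => ⟨?_, ?_⟩⟩
  · have hev : ∀ᶠ s in 𝓝 v, s ∈ Ioo (-δ) δ := isOpen_Ioo.mem_nhds hv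
    refine H.velocity_parallel_of_eulerLagrange hE hP (y := fun s => (ψ (u, s)).1)
      (p := fun s => (metricForm (E := E) h (ψ (u, s)).1).inverse (ψ (u, s)).2) ?_ ?_ ?_ ?_ ?_
    · filter_upwards [hev] with s hs
      exact (hψU ⟨hu, hs⟩).1
    · have h1 : ContDiffAt ℝ ∞ ψ (u, v) := hψ.contDiffAt (hopen.mem_nhds ⟨hu, hv⟩)
      have h2 : ContDiffAt ℝ ∞ (fun s : ℝ => (u, s)) v := contDiffAt_const.prodMk contDiffAt_id
      exact contDiff_fst.contDiffAt.comp v (ContDiffAt.comp v h1 h2)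
    · filter_upwards [hev] with s hs
      exact (hψd (u, s) ⟨hu, hs⟩).fst
    · exact hflat _ (hψU ⟨hu, hv⟩).1
    · intro e
      -- The momentum is the metric dual of the velocity, so Hamilton's momentum equation is the
      -- Euler-Lagrange equation.
      have h1 : HasDerivAt (fun s => (ψ (u, s)).2) (geodesicField (E := E) h (ψ (u, v))).2 v :=
        HasFDerivAt.comp_hasDerivAt (f := fun s => ψ (u, s)) v hasFDerivAt_snd (hψd (u, v) ⟨hu, hv⟩)
      have h2 := h1.clm_apply (hasDerivAt_const v e)
      rw [map_zero, add_zero] at h2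
      refine h2.congr_of_eventuallyEq ?_
      filter_upwards [hev] with s hs
      rw [H.metricForm_inverse_apply (hψU ⟨hu, hs⟩).1]
  · rw [hT _ (hψU ⟨hu, hv⟩).1]
    exact Submodule.zero_mem _

/-- The integral curves of the tangential part of a transverse axis are geodesics. -/
theorem hasRuledCoordinates_of_ne (H : LocalSurface h U ν) (A : LocalAxis h U ν V k)
    (hE : Module.finrank ℝ E = 3) (hP : Module.finrank ℝ P = 2) (hk : k ^ 2 ≠ 1)
    {x₀ : P} (hx₀ : x₀ ∈ U) :
    HasRuledCoordinates h U (fun q => V q - k • ν q) x₀ := by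
  have : FiniteDimensional ℝ P := Module.finite_of_finrank_eq_succ hP
  -- The tangential part of the axis in the parameter plane. Defining it as the metric dual of ⟨V,
  -- dh ·⟩ makes its smoothness visible; `hpush` identifies its image.
  let τ : P → P := fun y => (metricForm (E := E) h y).inverse (dualForm h V y)
  have hτ : ContDiffOn ℝ ∞ τ U := H.contDiffOn_metricForm_inverse.clm_apply (H.contDiffOn_dualForm A)
  have hpush : ∀ y ∈ U, pushField h (τ y) y = V y - k • ν y := by
    intro y hy
    obtain ⟨a, ha⟩ := H.exists_pushField_eq hE hP hy _ (H.inner_tangential_normal A hy)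
    have h1 : metricForm (E := E) h y a = dualForm h V y := by
      ext b
      rw [metricForm_apply, dualForm_apply, ha, inner_sub_left, inner_smul_left,
        real_inner_comm, real_inner_comm (pushField h b y) (ν y), H.orthogonal y hy b, mul_zero,
        sub_zero, real_inner_comm]
    have h2 : τ y = a := by
      change (metricForm (E := E) h y).inverse (dualForm h V y) = a
      rw [← h1, H.inverse_metricForm_apply hy]
    rw [h2, ha]
  have hne : ∀ y ∈ U, τ y ≠ 0 := by
    intro y hy h0
    have h1 := H.inner_tangential_self A hy
    rw [← hpush y hy, h0, pushField_zero, inner_zero_left] at h1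
    exact hk (by linarith)
  obtain ⟨d, hd⟩ := exists_pair hP (hne x₀ hx₀)
  obtain ⟨δ, hδ, ψ, hψ0, hψ, hψU, hψd, hinj, himm⟩ :=
    SmoothFlow.exists_flow_parametrization hP H.isOpen hτ hx₀ (ContinuousLinearMap.id ℝ P) d hd
  refine ⟨δ, hδ, ψ, hψ0, hψ, hψU, hinj, himm, fun u hu v hv => ?_⟩
  have hvel : ∀ s ∈ Ioo (-δ) δ, velocity (E := E) (fun s => h (ψ (u, s))) s =
      V (ψ (u, s)) - k • ν (ψ (u, s)) := by
    intro s hs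
    rw [velocity_comp (hψd (u, s) ⟨hu, hs⟩)
      ((H.contMDiffAt (hψU ⟨hu, hs⟩)).mdifferentiableAt (by simp))]
    exact hpush _ (hψU ⟨hu, hs⟩)
  have hy : ψ (u, v) ∈ U := hψU ⟨hu, hv⟩
  refine ⟨?_, ?_⟩
  · have hd1 := (H.isDiffFieldAt_axis A hy).sub_smul (H.isDiffFieldAt_normal hy) k
    have h1 := covDeriv_curve (y := fun s => ψ (u, s)) hd1 (hψd (u, v) ⟨hu, hv⟩)
    have h2 : ∀ᶠ s in 𝓝 v, velocity (E := E) (fun s => h (ψ (u, s))) s =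
        V (ψ (u, s)) - k • ν (ψ (u, s)) := by
      filter_upwards [isOpen_Ioo.mem_nhds hv] with s hs
      exact hvel s hs
    rw [covDeriv_congr h2, h1]
    refine H.eq_zero_of_inner hE hP hy _ ?_ fun b => ?_
    · rw [inner_dirCov_sub_smul (H.isDiffFieldAt_axis A hy) (H.isDiffFieldAt_normal hy)
        (H.isDiffFieldAt_normal hy), A.parallel _ hy, H.inner_dirCov_normal_normal hy]
      simp
    -- Symmetry of the shape operator turns ⟨∇_T ν, b⟩ into ⟨∇_b ν, T⟩, which vanishes.
    · rw [inner_dirCov_sub_smul (H.isDiffFieldAt_axis A hy) (H.isDiffFieldAt_normal hy)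
        (H.isDiffFieldAt_push hy b), A.parallel _ hy, H.inner_dirCov_normal_symm hy, hpush _ hy,
        inner_sub_right, H.inner_dirCov_normal_axis A hy, inner_smul_right,
        H.inner_dirCov_normal_normal hy]
      simp
  · rw [hvel v hv]
    exact Submodule.mem_span_singleton_self _

/-- A surface with a parallel axis of constant angle is locally ruled by geodesics that are tangent
to the projection of the axis. -/
theorem hasRuledCoordinates (H : LocalSurface h U ν) (A : LocalAxis h U ν V k)
    (hE : Module.finrank ℝ E = 3) (hP : Module.finrank ℝ P = 2) {x₀ : P} (hx₀ : x₀ ∈ U) :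
    HasRuledCoordinates h U (fun q => V q - k • ν q) x₀ := by
  by_cases hk : k ^ 2 = 1
  · refine H.hasRuledCoordinates_of_flat hE hP
      (fun y hy => H.inner_dirCov_normal_eq_zero A hk hy) (fun y hy => ?_) hx₀
    rw [← inner_self_eq_zero (𝕜 := ℝ), H.inner_tangential_self A hy, hk, sub_self]
  · exact H.hasRuledCoordinates_of_ne A hE hP hk hx₀

end LocalSurface

end ConstAngle

end

/-! ### From charts to the immersed surface -/

noncomputable section

namespace ConstAngle

section Global

variable {M : Type*} [TopologicalSpace M] [ChartedSpace (EuclideanSpace ℝ (Fin 3)) M]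
  [IsManifold (𝓡 3) ∞ M] [RiemannianBundle (fun x : M => TangentSpace (𝓡 3) x)]
  {S : Type*} [TopologicalSpace S] [ChartedSpace (EuclideanSpace ℝ (Fin 2)) S]
  [IsManifold (𝓡 2) ∞ S]
  {f : S → M} {ν V : ∀ p, TangentSpace (𝓡 3) (f p)} {θ : ℝ}

/-- The local parametrization of the surface given by the chart around `p`. -/
abbrev chartPar (p : S) : EuclideanSpace ℝ (Fin 2) → S := (extChartAt (𝓡 2) p).symm

omit [IsManifold (𝓡 2) ∞ S] in
lemma isOpen_chartTarget (p : S) : IsOpen (extChartAt (𝓡 2) p).target := isOpen_extChartAt_target p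

lemma contMDiffAt_chartPar (p : S) {y : EuclideanSpace ℝ (Fin 2)}
    (hy : y ∈ (extChartAt (𝓡 2) p).target) :
    ContMDiffAt 𝓘(ℝ, EuclideanSpace ℝ (Fin 2)) (𝓡 2) ∞ (chartPar p) y :=
  (contMDiffOn_extChartAt_symm p).contMDiffAt ((isOpen_chartTarget p).mem_nhds hy)

lemma mfderiv_chartPar_injective (p : S) {y : EuclideanSpace ℝ (Fin 2)}
    (hy : y ∈ (extChartAt (𝓡 2) p).target) :
    Function.Injective (mfderiv 𝓘(ℝ, EuclideanSpace ℝ (Fin 2)) (𝓡 2) (chartPar p) y) := by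
  have : IsManifold (𝓡 2) 1 S := IsManifold.of_le (n := ∞) (by simp)
  have h1 := isInvertible_mfderivWithin_extChartAt_symm (I := 𝓡 2) hy
  rw [ModelWithCorners.range_eq_univ, mfderivWithin_univ] at h1
  exact h1.injective

/-- At the centre of its own chart the tangent space is identified with the model space, so the
local null direction can be used unchanged in the coordinate basis of `extrinsicCurvature`. -/
lemma mfderiv_chartPar_self (p : S) (w : EuclideanSpace ℝ (Fin 2)) :
    mfderiv 𝓘(ℝ, EuclideanSpace ℝ (Fin 2)) (𝓡 2) (chartPar p) (extChartAt (𝓡 2) p p)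
      ((NormedSpace.fromTangentSpace _).symm w) =
      (show TangentSpace (𝓡 2) (chartPar p (extChartAt (𝓡 2) p p)) from w) := by
  have : IsManifold (𝓡 2) 1 S := IsManifold.of_le (n := ∞) (by simp)
  have h1 := mfderivWithin_range_extChartAt_symm (I := 𝓡 2) (x := p)
  rw [ModelWithCorners.range_eq_univ, mfderivWithin_univ] at h1
  rw [h1]
  rfl

lemma pushField_chartPar (hf : IsSurfaceWithNormal f ν) (p : S) {y : EuclideanSpace ℝ (Fin 2)}
    (hy : y ∈ (extChartAt (𝓡 2) p).target) (a : EuclideanSpace ℝ (Fin 2)) :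
    pushField (E := EuclideanSpace ℝ (Fin 3)) (fun y => f (chartPar p y)) a y =
      mfderiv (𝓡 2) (𝓡 3) f (chartPar p y)
        (mfderiv 𝓘(ℝ, EuclideanSpace ℝ (Fin 2)) (𝓡 2) (chartPar p) y
          ((NormedSpace.fromTangentSpace y).symm a)) :=
  mfderiv_comp_apply y (hf.smooth.mdifferentiableAt (by simp))
    ((contMDiffAt_chartPar p hy).mdifferentiableAt (by simp)) _

lemma localSurface_chart (hf : IsSurfaceWithNormal f ν) (p : S) :
    LocalSurface (E := EuclideanSpace ℝ (Fin 3)) (fun y => f (chartPar p y))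
      (extChartAt (𝓡 2) p).target (fun y => ν (chartPar p y)) where
  isOpen := isOpen_chartTarget p
  smooth := hf.smooth.comp_contMDiffOn (contMDiffOn_extChartAt_symm p)
  immersion y hy a ha := by
    rw [pushField_chartPar hf p hy, ← map_zero (mfderiv (𝓡 2) (𝓡 3) f (chartPar p y))] at ha
    have h1 := hf.immersion _ ha
    rw [← map_zero (mfderiv 𝓘(ℝ, EuclideanSpace ℝ (Fin 2)) (𝓡 2) (chartPar p) y)] at h1
    exact mfderiv_chartPar_injective p hy h1
  smooth_normal := ContMDiff.comp_contMDiffOn hf.smooth_normal (contMDiffOn_extChartAt_symm p)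
  norm_normal y _ := hf.norm_normal _
  orthogonal y hy a := by
    rw [pushField_chartPar hf p hy]
    exact hf.orthogonal _ _

omit [IsManifold (𝓡 2) ∞ S] in
lemma inner_axis_normal (hf : IsSurfaceWithNormal f ν) (hV : IsConstParallelAngle f ν θ V) (p : S) :
    inner ℝ (V p) (ν p) = Real.cos θ := by
  have h1 := InnerProductGeometry.cos_angle_mul_norm_mul_norm (V p) (ν p)
  rw [hV.angle_eq, hV.norm_eq_one, hf.norm_normal, mul_one, mul_one] at h1
  exact h1.symm

variable [IsContMDiffRiemannianBundle (𝓡 3) ∞ (EuclideanSpace ℝ (Fin 3))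
      (fun x : M => TangentSpace (𝓡 3) x)]

omit [IsContMDiffRiemannianBundle (𝓡 3) ∞ (EuclideanSpace ℝ (Fin 3))
      (fun x : M => TangentSpace (𝓡 3) x)] in
lemma localAxis_chart (hf : IsSurfaceWithNormal f ν) (hV : IsConstParallelAngle f ν θ V) (p : S) :
    LocalAxis (E := EuclideanSpace ℝ (Fin 3)) (fun y => f (chartPar p y))
      (extChartAt (𝓡 2) p).target (fun y => ν (chartPar p y)) (fun y => V (chartPar p y))
      (Real.cos θ) where
  smooth := ContMDiff.comp_contMDiffOn hV.smooth (contMDiffOn_extChartAt_symm p)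
  norm_eq_one y _ := hV.norm_eq_one _
  inner_eq y _ := inner_axis_normal hf hV _
  parallel y hy a := by
    have hV' : IsDiffFieldAt (F := EuclideanSpace ℝ (Fin 2)) (fun y => f (chartPar p y))
        (fun y => V (chartPar p y)) y :=
      ((ContMDiff.comp_contMDiffOn hV.smooth (contMDiffOn_extChartAt_symm p)).contMDiffAt
        ((isOpen_chartTarget p).mem_nhds hy)).mdifferentiableAt (by simp)
    -- Parallelism is assumed only along curves; the straight chart line with velocity a recovers
    -- the derivative in the direction a.
    let l : ℝ → EuclideanSpace ℝ (Fin 2) := fun t => y + t • a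
    have hl : ContDiff ℝ ∞ l := by fun_prop
    have hl0 : l 0 = y := by simp [l]
    have hld : HasDerivAt l a 0 := by
      have h := ((hasDerivAt_id (0 : ℝ)).smul_const a).const_add y
      rw [one_smul] at h
      exact h
    have h1 := hV.parallel (fun t => chartPar p (l t)) (l ⁻¹' (extChartAt (𝓡 2) p).target)
      ((isOpen_chartTarget p).preimage hl.continuous)
      ((contMDiffOn_extChartAt_symm p).comp hl.contMDiff.contMDiffOn fun t ht => ht) 0
      (by rw [mem_preimage, hl0]; exact hy)
    rw [← hl0] at hV'
    have h2 := LocalSurface.covDeriv_curve (h := fun y => f (chartPar p y))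
      (W := fun y => V (chartPar p y)) hV' hld
    rw [← hl0]
    exact h2.symm.trans h1

/-- The surface is extrinsically flat. -/
theorem isExtrinsicallyFlat (hf : IsSurfaceWithNormal f ν) (hV : IsConstParallelAngle f ν θ V) :
    IsExtrinsicallyFlat f ν := by
  intro p
  let x := extChartAt (𝓡 2) p p
  have hx : x ∈ (extChartAt (𝓡 2) p).target := mem_extChartAt_target p
  have hxp : chartPar p x = p := extChartAt_to_inv p
  obtain ⟨a, ha0, ha⟩ := (localSurface_chart hf p).exists_dirCov_normal_orthogonal
    (localAxis_chart hf hV p) (by simp) (by simp) hx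
  have key : ∀ b : EuclideanSpace ℝ (Fin 2),
      secondForm f ν p (show TangentSpace (𝓡 2) p from b) (show TangentSpace (𝓡 2) p from a) = 0 := by
    intro b
    have h1 := ha b
    have hν : IsDiffFieldAt (F := EuclideanSpace ℝ (Fin 2)) f ν (chartPar p x) :=
      hf.smooth_normal.mdifferentiableAt (by simp)
    rw [pushField_chartPar hf p hx, dirCov, covDeriv_comp hν
      ((contMDiffAt_chartPar p hx).mdifferentiableAt (by simp)), mfderiv_chartPar_self,
      mfderiv_chartPar_self] at h1
    -- The point `chartPar p x` equals p only propositionally, so the statement is transported over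
    -- a free base point q.
    have h2 : ∀ q : S, q = p →
        inner ℝ (covDeriv (EuclideanSpace ℝ (Fin 2)) f ν q (show TangentSpace (𝓡 2) q from b))
          (mfderiv (𝓡 2) (𝓡 3) f q (show TangentSpace (𝓡 2) q from a)) = 0 →
        inner ℝ (covDeriv (EuclideanSpace ℝ (Fin 2)) f ν p (show TangentSpace (𝓡 2) p from b))
          (mfderiv (𝓡 2) (𝓡 3) f p (show TangentSpace (𝓡 2) p from a)) = 0 := by
      rintro q rfl h
      exact h
    have h3 := h2 _ hxp h1
    rw [secondForm, inner_neg_left, h3, neg_zero]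
  have hdec : (show TangentSpace (𝓡 2) p from a) = a 0 • tangentBasis p 0 + a 1 • tangentBasis p 1 := by
    have : a = a 0 • EuclideanSpace.single 0 (1 : ℝ) + a 1 • EuclideanSpace.single 1 (1 : ℝ) := by
      ext i
      fin_cases i <;> simp
    exact this
  have hdet : (Matrix.of fun i j => secondForm f ν p (tangentBasis p i) (tangentBasis p j)).det = 0 := by
    -- The coordinates of the null direction form a nonzero kernel vector of the matrix of the
    -- second fundamental form.
    refine Matrix.exists_mulVec_eq_zero_iff.1 ⟨fun i => a i, fun h0 => ha0 ?_, ?_⟩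
    · ext i
      exact congrFun h0 i
    · ext i
      have h1 := key (tangentBasis p i)
      have h2 : secondForm f ν p (tangentBasis p i) (show TangentSpace (𝓡 2) p from a) = 0 := h1
      rw [hdec] at h2
      simp only [secondForm, map_add, map_smul, inner_add_right, inner_smul_right] at h2
      simp only [Matrix.mulVec, dotProduct, Fin.sum_univ_two, Matrix.of_apply, Pi.zero_apply,
        secondForm]
      linarith
  rw [extrinsicCurvature, hdet, zero_div]

/-- The surface is ruled by geodesics tangent to the projection of the axis. -/
theorem isRuledAlong (hf : IsSurfaceWithNormal f ν) (hV : IsConstParallelAngle f ν θ V) :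
    IsRuledAlong f (tangentialPart f ν V) := by
  intro p
  have hx : extChartAt (𝓡 2) p p ∈ (extChartAt (𝓡 2) p).target := mem_extChartAt_target p
  obtain ⟨δ, hδ, Y, hY0, hY, hYU, hinj, himm, hgeo⟩ :=
    (localSurface_chart hf p).hasRuledCoordinates (localAxis_chart hf hV p) (by simp) (by simp) hx
  have hopen : IsOpen (Ioo (-δ) δ ×ˢ Ioo (-δ) δ) := isOpen_Ioo.prod isOpen_Ioo
  have hX : ContMDiffOn 𝓘(ℝ, ℝ × ℝ) (𝓡 2) ∞ (fun z => chartPar p (Y z))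
      (Ioo (-δ) δ ×ˢ Ioo (-δ) δ) :=
    (contMDiffOn_extChartAt_symm p).comp hY.contMDiffOn hYU
  refine ⟨δ, fun z => chartPar p (Y z), ⟨hδ, ?_, hX, ?_, ?_, ?_⟩, ?_⟩
  · rw [hY0]
    exact extChartAt_to_inv p
  · intro z hz
    have hd : DifferentiableAt ℝ Y z :=
      (hY.contDiffAt (hopen.mem_nhds hz)).differentiableAt (by simp)
    have h1 : mfderiv 𝓘(ℝ, ℝ × ℝ) (𝓡 2) (fun z => chartPar p (Y z)) z =
        (mfderiv 𝓘(ℝ, EuclideanSpace ℝ (Fin 2)) (𝓡 2) (chartPar p) (Y z)).comp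
          (mfderiv 𝓘(ℝ, ℝ × ℝ) 𝓘(ℝ, EuclideanSpace ℝ (Fin 2)) Y z) :=
      mfderiv_comp z ((contMDiffAt_chartPar p (hYU hz)).mdifferentiableAt (by simp))
        hd.mdifferentiableAt
    rw [h1, mfderiv_eq_fderiv]
    exact (mfderiv_chartPar_injective p (hYU hz)).comp (himm z hz)
  · exact (extChartAt (𝓡 2) p).symm.injOn.comp hinj hYU
  · intro u hu
    refine ⟨?_, fun v hv => (hgeo u hu v hv).1⟩
    have h1 : ContMDiff 𝓘(ℝ, ℝ) 𝓘(ℝ, ℝ × ℝ) ∞ (fun v : ℝ => (u, v)) :=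
      (contDiff_const.prodMk contDiff_id).contMDiff
    exact hf.smooth.comp_contMDiffOn (hX.comp h1.contMDiffOn fun v hv => ⟨hu, hv⟩)
  · intro u hu v hv
    have h1 := (hgeo u hu v hv).2
    -- With ⟨V, ν⟩ replaced by the constant cos θ, the tangential part becomes the field of the
    -- local theorem.
    rw [tangentialPart, inner_axis_normal hf hV]
    exact h1

end Global

end ConstAngle

end

theorem theorem4p2
    {M : Type*} [TopologicalSpace M] [ChartedSpace (EuclideanSpace ℝ (Fin 3)) M]
    [IsManifold (𝓡 3) ∞ M] [RiemannianBundle (fun x : M => TangentSpace (𝓡 3) x)]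
    [IsContMDiffRiemannianBundle (𝓡 3) ∞ (EuclideanSpace ℝ (Fin 3))
      (fun x : M => TangentSpace (𝓡 3) x)]
    {S : Type*} [TopologicalSpace S] [ChartedSpace (EuclideanSpace ℝ (Fin 2)) S]
    [IsManifold (𝓡 2) ∞ S]
    (f : S → M) (ν : ∀ p, TangentSpace (𝓡 3) (f p))
    (hf : ConstAngle.IsSurfaceWithNormal f ν)
    (θ : ℝ) (V : ∀ p, TangentSpace (𝓡 3) (f p))
    (hV : ConstAngle.IsConstParallelAngle f ν θ V) :
    ConstAngle.IsExtrinsicallyFlat f ν ∧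
      ConstAngle.IsRuled f ∧
      ConstAngle.IsRuledAlong f (ConstAngle.tangentialPart f ν V) := by
  have h := ConstAngle.isRuledAlong hf hV
  refine ⟨ConstAngle.isExtrinsicallyFlat hf hV, fun p => ?_, h⟩
  obtain ⟨δ, X, hX, -⟩ := h p
  exact ⟨δ, X, hX⟩
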